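/- Let $A$ be a hereditary artin algebra, that is, a ring which is finitely generated as a module over a commutative artinian ring $k_0$ (for some structure of $A$ as a $k_0$-algebra) and all of whose left ideals are projective. Modules are left modules unless said otherwise. Let $k$ be the center of $A$ (a semisimple ring) and $D=\operatorname{Hom}_k(-,k)$ the standard duality between finitely generated left and right modules. As $A$ is hereditary, the transpose is the functor $\operatorname{Tr}M=\operatorname{Ext}^1(M,A)$ between left and right $A$-modules, and the Auslander--Reiten translations are the functors $\tau=D\operatorname{Tr}$ and $\tau^{-1}=\operatorname{Tr}D$. Let $T$ be a tilting $A$-module: $T$ is finitely generated, of projective dimension at most $1$, $\operatorname{Ext}^1_A(T,T)=0$, and there is an exact sequence $0\to A\to T_0\to T_1\to 0$ in which $T_0,T_1$ are direct summands of finite direct sums of copies of $T$. Let $B=\operatorname{End}_A(T)$, where endomorphisms are written (and composed) on the side opposite to the scalars, so that $T$ is an $A$-$B$-bimodule. By functoriality, $\tau T$ and $\tau^{-1}T$ are then $A$-$B$-bimodules as well, and for $A$-$B$-bimodules $X,Y$ the group $\operatorname{Ext}^1_A(X,Y)$ is a $B$-$B$-bimodule (the left action comes from $X$, the right action from $Y$).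 In the same way $\operatorname{Ext}^2_B(DB,B)$ is a $B$-$B$-bimodule, by means of the $B$-$B$-bimodules $B$ and $DB=\operatorname{Hom}_k(B,k)$. Then the three $B$-$B$-bimodules $$\operatorname{Ext}^2_B(DB,B),\qquad \operatorname{Ext}^1_A(T,\tau^{-1}T),\qquad \operatorname{Ext}^1_A(\tau T,T)$$ are isomorphic to one another as $B$-$B$-bimodules. -/

import Mathlib

open CategoryTheory Opposite

universe v w u u₁ v₁ u₂ v₂

namespace TiltedAlg

noncomputable section

/-! ### Bimodules -/

/-- A `B`-`B`-bimodule: an abelian group with commuting left and right actions of `B`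
(a right action of `B` is a left action of `Bᵐᵒᵖ`). -/
structure Bimod (B : Type u) [Ring B] where
  carrier : Type u
  [addCommGroup : AddCommGroup carrier]
  [leftModule : Module B carrier]
  [rightModule : Module Bᵐᵒᵖ carrier]
  [smulCommClass : SMulCommClass B Bᵐᵒᵖ carrier]

attribute [instance] Bimod.addCommGroup Bimod.leftModule Bimod.rightModule Bimod.smulCommClass

/-- An isomorphism of `B`-`B`-bimodules: an additive bijection which commutes with the left and
with the right action. -/
structure Bimod.Iso {B : Type u} [Ring B] (M N : Bimod B) where
  toAddEquiv : M.carrier ≃+ N.carrier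
  map_smul_left : ∀ (b : B) (x : M.carrier), toAddEquiv (b • x) = b • toAddEquiv x
  map_smul_right : ∀ (b : B) (x : M.carrier),
    toAddEquiv (MulOpposite.op b • x) = MulOpposite.op b • toAddEquiv x

section Ext

variable {C : Type u₁} [Category.{v₁} C] [Abelian C] [HasExt.{u} C]

/-- If `S` acts on `X` from the right, then `Ext^n(X, Y)` is a left `S`-module, by contravariant
functoriality in `X`. (The product in `End X` is the composition of functions.) -/
@[reducible]
def extLeftModule {S : Type w} [Ring S] (n : ℕ) (X Y : C) (ρ : S →+* (End X)ᵐᵒᵖ) :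
    Module S (Abelian.Ext.{u} X Y n) where
  smul b x := (Abelian.Ext.mk₀ (ρ b).unop).comp x (zero_add n)
  one_smul x := by
    change (Abelian.Ext.mk₀ (ρ 1).unop).comp x (zero_add n) = x
    rw [map_one]; exact Abelian.Ext.mk₀_id_comp x
  mul_smul a b x := by
    change (Abelian.Ext.mk₀ (ρ (a * b)).unop).comp x (zero_add n) =
      (Abelian.Ext.mk₀ (ρ a).unop).comp
        ((Abelian.Ext.mk₀ (ρ b).unop).comp x (zero_add n)) (zero_add n)
    rw [map_mul, Abelian.Ext.mk₀_comp_mk₀_assoc]; rfl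
  smul_zero b := Abelian.Ext.comp_zero _ _ _ _ _
  smul_add b x y := Abelian.Ext.comp_add _ _ _ _
  add_smul a b x := by
    change (Abelian.Ext.mk₀ (ρ (a + b)).unop).comp x (zero_add n) =
      (Abelian.Ext.mk₀ (ρ a).unop).comp x (zero_add n) +
        (Abelian.Ext.mk₀ (ρ b).unop).comp x (zero_add n)
    rw [map_add, MulOpposite.unop_add, Abelian.Ext.mk₀_add, Abelian.Ext.add_comp]
  zero_smul x := by
    change (Abelian.Ext.mk₀ (ρ 0).unop).comp x (zero_add n) = 0
    rw [map_zero, MulOpposite.unop_zero, Abelian.Ext.mk₀_zero, Abelian.Ext.zero_comp]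

/-- If `S` acts on `Y` from the left, then `Ext^n(X, Y)` is a left `S`-module, by covariant
functoriality in `Y`. (It is used for `S = Bᵐᵒᵖ`, that is, for right actions of `B`.) -/
@[reducible]
def extRightModule {S : Type w} [Ring S] (n : ℕ) (X Y : C) (σ : S →+* End Y) :
    Module S (Abelian.Ext.{u} X Y n) where
  smul b x := x.comp (Abelian.Ext.mk₀ (σ b)) (add_zero n)
  one_smul x := by
    change x.comp (Abelian.Ext.mk₀ (σ 1)) (add_zero n) = x
    rw [map_one]; exact Abelian.Ext.comp_mk₀_id x
  mul_smul a b x := by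
    change x.comp (Abelian.Ext.mk₀ (σ (a * b))) (add_zero n) =
      (x.comp (Abelian.Ext.mk₀ (σ b)) (add_zero n)).comp
        (Abelian.Ext.mk₀ (σ a)) (add_zero n)
    rw [map_mul, End.mul_def, ← Abelian.Ext.mk₀_comp_mk₀]
    symm
    apply Abelian.Ext.comp_assoc
    omega
  smul_zero b := Abelian.Ext.zero_comp _ _ _ _ (add_zero n)
  smul_add b x y := Abelian.Ext.add_comp _ _ _ _
  add_smul a b x := by
    change x.comp (Abelian.Ext.mk₀ (σ (a + b))) (add_zero n) =
      x.comp (Abelian.Ext.mk₀ (σ a)) (add_zero n) +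
        x.comp (Abelian.Ext.mk₀ (σ b)) (add_zero n)
    rw [map_add, Abelian.Ext.mk₀_add, Abelian.Ext.comp_add]
  zero_smul x := by
    change x.comp (Abelian.Ext.mk₀ (σ 0)) (add_zero n) = 0
    rw [map_zero, Abelian.Ext.mk₀_zero, Abelian.Ext.comp_zero]

/-- If `B` acts from the right on `X` and on `Y`, then `Ext^n(X, Y)` is a `B`-`B`-bimodule: the
left action comes from `X`, the right action from `Y`. -/
def extBimod {B : Type u} [Ring B] (n : ℕ) (X Y : C)
    (ρ : B →+* (End X)ᵐᵒᵖ) (σ : Bᵐᵒᵖ →+* End Y) : Bimod B :=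
  letI l := extLeftModule n X Y ρ
  letI r := extRightModule n X Y σ
  haveI : SMulCommClass B Bᵐᵒᵖ (Abelian.Ext.{u} X Y n) := ⟨fun b c x => by
    change (Abelian.Ext.mk₀ (ρ b).unop).comp
        (x.comp (Abelian.Ext.mk₀ (σ c)) (add_zero n)) (zero_add n) =
      ((Abelian.Ext.mk₀ (ρ b).unop).comp x (zero_add n)).comp
        (Abelian.Ext.mk₀ (σ c)) (add_zero n)
    symm
    apply Abelian.Ext.comp_assoc
    omega⟩
  { carrier := Abelian.Ext.{u} X Y n }

end Ext

/-! ### Endomorphism rings and functors -/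

section End

variable {C : Type u₁} [Category.{v₁} C] [Preadditive C]
  {D : Type u₂} [Category.{v₂} D] [Preadditive D]

/-- The ring homomorphism `End X → End (F X)` given by a covariant additive functor. -/
def mapEndHom (F : C ⥤ D) [F.Additive] (X : C) : End X →+* End (F.obj X) where
  toFun f := F.map f
  map_one' := F.map_id X
  map_mul' f g := F.map_comp g f
  map_zero' := F.map_zero X X
  map_add' _ _ := F.map_add

/-- The ring homomorphism `End X → (End (F X))ᵒᵖ` given by a contravariant additive functor. -/
def mapEndHomOp (F : Cᵒᵖ ⥤ D) [F.Additive] (X : C) : End X →+* (End (F.obj (op X)))ᵐᵒᵖ where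
  toFun f := MulOpposite.op (F.map (Quiver.Hom.op f))
  map_one' := by
    apply MulOpposite.unop_injective
    exact F.map_id (op X)
  map_mul' f g := by
    apply MulOpposite.unop_injective
    exact F.map_comp (Quiver.Hom.op f) (Quiver.Hom.op g)
  map_zero' := by
    apply MulOpposite.unop_injective
    exact F.map_zero (op X) (op X)
  map_add' f g := by
    apply MulOpposite.unop_injective
    exact F.map_add (f := Quiver.Hom.op f) (g := Quiver.Hom.op g)

end End

/-- The action of `S` on an `R`-module `M`, for commuting actions of `R` and `S`, as a ring
homomorphism to the endomorphism ring of the object `M` of `R`-Mod. -/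
def actHom (R : Type u) [Ring R] (S : Type u) [Ring S] (M : Type u) [AddCommGroup M]
    [Module R M] [Module S M] [SMulCommClass S R M] : S →+* End (ModuleCat.of R M) :=
  (ModuleCat.endRingEquiv (ModuleCat.of R M)).symm.toRingHom.comp (Module.toModuleEnd R M)

/-! ### Duality, transpose and the Auslander-Reiten translations -/

section Functors

variable (K : Type u) [CommRing K] (R : Type u) [Ring R] [Algebra K R]

/-- The underlying group of `D M = Hom_K(M, K)`, for a left module `M` over a `K`-algebra `R`. -/
abbrev DualCarrier (M : ModuleCat.{u} R) : Type u :=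
  (ModuleCat.restrictScalars (algebraMap K R)).obj M →ₗ[K] K

/-- The right action of `R` on `Hom_K(M, K)`: `(f r)(x) = f (r x)`. -/
instance dualModule (M : ModuleCat.{u} R) : Module Rᵐᵒᵖ (DualCarrier K R M) where
  smul r f :=
    { toFun := fun x => f (r.unop • (show M from x) : M)
      map_add' := fun x y => by
        change f (r.unop • ((show M from x) + (show M from y)) : M) = _
        rw [smul_add]; exact map_add f _ _
      map_smul' := fun c x => by
        have h : (r.unop • (algebraMap K R c • (show M from x)) : M) =
            algebraMap K R c • (r.unop • (show M from x) : M) := by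
          rw [smul_smul, smul_smul, Algebra.commutes]
        change f (r.unop • (algebraMap K R c • (show M from x)) : M) = _
        rw [h]; exact map_smul f c _ }
  one_smul f := by
    ext x
    change f ((1 : R) • (show M from x) : M) = f x
    rw [one_smul]
  mul_smul r s f := by
    ext x
    change f ((s.unop * r.unop) • (show M from x) : M) = f (s.unop • (r.unop • (show M from x)) : M)
    rw [mul_smul]
  smul_zero r := rfl
  smul_add r f g := rfl
  add_smul r s f := by
    ext x
    change f ((r.unop + s.unop) • (show M from x) : M) =
      f (r.unop • (show M from x) : M) + f (s.unop • (show M from x) : M)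
    rw [add_smul]; exact map_add f _ _
  zero_smul f := by
    ext x
    change f ((0 : R) • (show M from x) : M) = 0
    rw [zero_smul]; exact map_zero f

/-- The functor `D = Hom_K(-, K)` from left `R`-modules to right `R`-modules. -/
def dual : (ModuleCat.{u} R)ᵒᵖ ⥤ ModuleCat.{u} Rᵐᵒᵖ where
  obj M := ModuleCat.of Rᵐᵒᵖ (DualCarrier K R M.unop)
  map {M N} φ := ModuleCat.ofHom
    { toFun := fun f =>
        f.comp ((ModuleCat.restrictScalars (algebraMap K R)).map φ.unop).hom
      map_add' := fun f g => rfl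
      map_smul' := fun r f => by
        ext x
        change f (r.unop • (φ.unop.hom x) : M.unop) =
          f (φ.unop.hom (r.unop • (show N.unop from x)) : M.unop)
        rw [map_smul] }

instance : (dual K R).Additive where
  map_add {M N φ ψ} := by
    ext f
    refine LinearMap.ext fun x => ?_
    exact map_add (show DualCarrier K R M.unop from f) _ _

/-- The right `R`-module `Ext^1_R(M, R)`: `R` acts through the right multiplications on `R`. -/
def transposeObj (M : ModuleCat.{u} R) : ModuleCat.{u} Rᵐᵒᵖ :=
  letI := extRightModule 1 M (ModuleCat.of R R) (actHom R Rᵐᵒᵖ R)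
  ModuleCat.of Rᵐᵒᵖ (Abelian.Ext.{u} M (ModuleCat.of R R) 1)

/-- The map `Ext^1_R(N, R) → Ext^1_R(M, R)` induced by `φ : M → N`. -/
def transposeMap {M N : ModuleCat.{u} R} (φ : M ⟶ N) : transposeObj R N ⟶ transposeObj R M :=
  letI := extRightModule 1 M (ModuleCat.of R R) (actHom R Rᵐᵒᵖ R)
  letI := extRightModule 1 N (ModuleCat.of R R) (actHom R Rᵐᵒᵖ R)
  ModuleCat.ofHom (X := Abelian.Ext.{u} N (ModuleCat.of R R) 1)
    (Y := Abelian.Ext.{u} M (ModuleCat.of R R) 1)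
    { toFun := fun x => (Abelian.Ext.mk₀ φ).comp x (zero_add 1)
      map_add' := fun x y => Abelian.Ext.comp_add _ _ _ _
      map_smul' := fun r x => by
        symm
        apply Abelian.Ext.comp_assoc
        rfl }

/-- The transpose `Tr M = Ext^1_R(M, R)` for a hereditary ring `R`, as a functor from left
`R`-modules to right `R`-modules. (In general, `Tr M` is the cokernel of
`Hom_R(P₀, R) → Hom_R(P₁, R)` for a minimal projective presentation `P₁ → P₀ → M → 0`. For a
hereditary ring, `P₁ → P₀` is injective, and this cokernel is `Ext^1_R(M, R)`.) -/
def transpose : (ModuleCat.{u} R)ᵒᵖ ⥤ ModuleCat.{u} Rᵐᵒᵖ where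
  obj M := transposeObj R M.unop
  map φ := transposeMap R φ.unop
  map_id M := by
    refine ModuleCat.hom_ext (LinearMap.ext fun x => ?_)
    exact Abelian.Ext.mk₀_id_comp (X := M.unop) (Y := ModuleCat.of R R) (n := 1) x
  map_comp {M N P} φ ψ := by
    refine ModuleCat.hom_ext (LinearMap.ext fun x => ?_)
    exact (Abelian.Ext.mk₀_comp_mk₀_assoc ψ.unop φ.unop
      (show Abelian.Ext.{u} M.unop (ModuleCat.of R R) 1 from x)).symm

instance : (transpose R).Additive where
  map_add {M N φ ψ} := by
    refine ModuleCat.hom_ext (LinearMap.ext fun x => ?_)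
    have h (y : Abelian.Ext.{u} M.unop (ModuleCat.of R R) 1) :
        (Abelian.Ext.mk₀ (φ.unop + ψ.unop)).comp y (zero_add 1) =
          (Abelian.Ext.mk₀ φ.unop).comp y (zero_add 1) +
            (Abelian.Ext.mk₀ ψ.unop).comp y (zero_add 1) := by
      rw [Abelian.Ext.mk₀_add, Abelian.Ext.add_comp]
    exact h x

end Functors

section Translations

variable (A : Type u) [Ring A]

/-- A right module over `Aᵐᵒᵖ` is a left module over `A`. -/
abbrev ofOpOp : ModuleCat.{u} Aᵐᵒᵖᵐᵒᵖ ⥤ ModuleCat.{u} A :=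
  ModuleCat.restrictScalars (RingEquiv.opOp A).toRingHom

/-- The Auslander-Reiten translation `τ = D Tr` of a hereditary artin algebra `A`. Here
`D = Hom_k(-, k)` for the center `k` of `A`. -/
def tau : ModuleCat.{u} A ⥤ ModuleCat.{u} A :=
  (transpose A).rightOp ⋙ dual (Subring.center A) Aᵐᵒᵖ ⋙ ofOpOp A

/-- The inverse Auslander-Reiten translation `τ⁻¹ = Tr D` of a hereditary artin algebra `A`. -/
def tauInv : ModuleCat.{u} A ⥤ ModuleCat.{u} A :=
  (dual (Subring.center A) A).rightOp ⋙ transpose Aᵐᵒᵖ ⋙ ofOpOp A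

instance : (tau A).Additive := by
  unfold tau; infer_instance

instance : (tauInv A).Additive := by
  unfold tauInv; infer_instance

end Translations

/-! ### Tilting modules and the tilted algebra -/

/-- `A` is hereditary: every left ideal is projective. -/
def IsHereditary (A : Type u) [Ring A] : Prop :=
  ∀ I : Ideal A, Module.Projective A I

section Tilting

variable (A : Type u) [Ring A] (T : Type u) [AddCommGroup T] [Module A T]

/-- `M` belongs to `add T`: it is a direct summand of `T^n` for some `n`. -/
def InAdd (M : Type u) [AddCommGroup M] [Module A M] : Prop :=
  ∃ (n : ℕ) (i : M →ₗ[A] (Fin n → T)) (p : (Fin n → T) →ₗ[A] M), p ∘ₗ i = LinearMap.id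

/-- `T` is a tilting `A`-module: it is finitely generated, of projective dimension at most one,
without self-extensions, and there is an exact sequence `0 → A → T₀ → T₁ → 0` with `T₀`, `T₁`
in `add T`. -/
structure IsTilting : Prop where
  finite : Module.Finite A T
  projectiveDimension_le_one : HasProjectiveDimensionLE (ModuleCat.of A T) 1
  ext_one_self : Subsingleton (Abelian.Ext.{u} (ModuleCat.of A T) (ModuleCat.of A T) 1)
  coresolution : ∃ (T₀ T₁ : ModuleCat.{u} A) (f : A →ₗ[A] T₀) (g : T₀ →ₗ[A] T₁),
    InAdd A T T₀ ∧ InAdd A T T₁ ∧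
      Function.Injective f ∧ Function.Exact f g ∧ Function.Surjective g

/-- The tilted algebra `B = End(T)`, acting on the left `A`-module `T` from the right: the product
of `B` is the composition of endomorphisms from left to right. Hence `Hom_A(T, M)` is a left
`B`-module. -/
abbrev TiltedAlgebra : Type u := (Module.End A T)ᵐᵒᵖ

/-- `T` as a right `B`-module in the category of `A`-modules. -/
def endHom : (TiltedAlgebra A T)ᵐᵒᵖ →+* End (ModuleCat.of A T) :=
  (ModuleCat.endRingEquiv (ModuleCat.of A T)).symm.toRingHom.comp
    (RingEquiv.opOp (Module.End A T)).symm.toRingHom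

/-- The right action of `B` on `F(T)`, for an additive endofunctor `F` of the category of
`A`-modules, as a ring homomorphism `Bᵐᵒᵖ → End (F T)`. -/
def functorAct (F : ModuleCat.{u} A ⥤ ModuleCat.{u} A) [F.Additive] :
    (TiltedAlgebra A T)ᵐᵒᵖ →+* End (F.obj (ModuleCat.of A T)) :=
  (mapEndHom F (ModuleCat.of A T)).comp (endHom A T)

/-- The same right action of `B` on `F(T)`, as a ring homomorphism `B → (End (F T))ᵐᵒᵖ`. -/
def functorActOp (F : ModuleCat.{u} A ⥤ ModuleCat.{u} A) [F.Additive] :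
    TiltedAlgebra A T →+* (End (F.obj (ModuleCat.of A T)))ᵐᵒᵖ :=
  (RingHom.op (functorAct A T F)).comp (RingEquiv.opOp (TiltedAlgebra A T)).toRingHom

/-- The `B`-`B`-bimodule `Ext^1_A(F T, G T)`, for additive endofunctors `F`, `G` of the category of
`A`-modules: `B` acts from the left through `F T` and from the right through `G T`. -/
def extOneBimod (F G : ModuleCat.{u} A ⥤ ModuleCat.{u} A) [F.Additive] [G.Additive] :
    Bimod (TiltedAlgebra A T) :=
  extBimod 1 (F.obj (ModuleCat.of A T)) (G.obj (ModuleCat.of A T))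
    (functorActOp A T F) (functorAct A T G)

/-- The `B`-`B`-bimodule `Ext^1_A(τT, T)`. -/
def extTauBimod : Bimod (TiltedAlgebra A T) :=
  extOneBimod A T (tau A) (𝟭 _)

/-- The `B`-`B`-bimodule `Ext^1_A(T, τ⁻¹T)`. -/
def extTauInvBimod : Bimod (TiltedAlgebra A T) :=
  extOneBimod A T (𝟭 _) (tauInv A)

end Tilting

section ExtTwo

variable (K : Type u) [CommRing K] (B : Type u) [Ring B] [Algebra K B]

/-- The left `B`-module `DB = Hom_K(B, K)`: `(b f)(x) = f (x b)`. It is the `K`-dual of the right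
`B`-module `B`. -/
def dualRegular : ModuleCat.{u} B :=
  (ofOpOp B).obj ((dual K Bᵐᵒᵖ).obj (op (ModuleCat.of Bᵐᵒᵖ B)))

/-- The right action of `B` on `DB`, `(f b)(x) = f (b x)`, induced by the left multiplications
on `B`. -/
def dualRegularAct : B →+* (End (dualRegular K B))ᵐᵒᵖ :=
  (mapEndHomOp (dual K Bᵐᵒᵖ ⋙ ofOpOp B) (ModuleCat.of Bᵐᵒᵖ B)).comp (actHom Bᵐᵒᵖ B B)

/-- The `B`-`B`-bimodule `Ext^2_B(DB, B)`, for left `B`-modules `DB` and `B`: the left action comes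
from the right action of `B` on `DB`, the right action from the right multiplications on `B`. -/
def extTwoBimod : Bimod B :=
  extBimod 2 (dualRegular K B) (ModuleCat.of B B) (dualRegularAct K B) (actHom B Bᵐᵒᵖ B)

end ExtTwo

end

end TiltedAlg

/-!
All three bimodules are quotients of one and the same abelian group by the same subgroup, in a way
that is compatible with the actions of `B`.

Choose a presentation `0 → P₁ → P₀ → T → 0` by finitely generated projective left modules, and a
presentation `0 → Q₁ → Q₀ → D T → 0` of the right module `D T` with `Q₀` finitely generated free.
Dualizing the second one gives an exact sequence `0 → T → D Q₀ → D Q₁ → 0`, in which both modules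
`D Q₀`, `D Q₁` are injective because `A` is hereditary. Let `M = Hom_A(P₁, Hom(Q₁, A))`, the group of
bilinear pairings `P₁ × Q₁ → A`. With the Nakayama functor `ν = D Hom_A(-, A)`, the duality identifies
`M` with `Hom_A(ν P₁, D Q₁)` (`nakayamaHom`). Let `N ⊆ M` be the subgroup of the morphisms which are
the sum of one that extends to `P₀` and one that lifts to `Hom(Q₀, A)` (`Decomposes`).

* Since `P₀` and `P₁` are projective and `Hom(Q₀, A) → Hom(Q₁, A) → τ⁻¹ T → 0` is exact,
  `Ext¹(T, τ⁻¹ T) = M / N` (`toExtTauInv`).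
* Since `D Q₀` and `D Q₁` are injective and `0 → τ T → ν P₁ → ν P₀` is exact,
  `Ext¹(τ T, T) = M / N` (`toExtTau`).
* Apply `D Hom_A(-, T)` to the first sequence and `G = Hom_A(T, -)` to the second one. As
  `Ext¹(T, T) = 0`, this gives short exact sequences of `B`-modules that end in `D B` and start in `B`,
  respectively. For a finitely generated projective module `P` one has `D Hom_A(P, T) = G ν P`
  (`isIso_dualHomToHom`). As `T` is a tilting module and `A` is hereditary, each injective module
  `X = ν P` has a resolution `0 → T₁ → T₀ → X → 0` by direct summands of finite sums of copies of `T`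
  (`IsTilting.exists_resolution`). Hence `G X` has projective dimension at most one,
  `Ext¹_B(G X, G J) = 0` for `J` injective, and `G` is fully faithful on morphisms from `X`
  (`IsTilting.isHomAdapted`). By dimension shifting, `Ext²_B(D B, B) = M / N` (`toExtTwo`).

In all three cases the quotient map is of the form `f ↦ x · f · y` for Yoneda products with fixed
classes `x` and `y` (`sandwich`). The action of `b ∈ B` from the left lifts to `M` through an
endomorphism of the sequence `P₁ → P₀ → T`, and the action from the right through an endomorphism of
`Q₁ → Q₀ → D T`, by the naturality of the extension class of a short exact sequence.
-/

namespace TiltedAlg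

noncomputable section

/-! ### Quotients of groups of morphisms -/

section Cover

/-- Two bimodules which are quotients of the same abelian group, with the same kernel, are
isomorphic, if both actions lift to operations on this group which serve both quotients. -/
theorem Bimod.nonempty_iso_of_surjective {B : Type u} [Ring B] {E₁ E₂ : Bimod B}
    {M : Type w} [AddCommGroup M] (F₁ : M →+ E₁.carrier) (F₂ : M →+ E₂.carrier)
    (h₁ : Function.Surjective F₁) (h₂ : Function.Surjective F₂)
    (hker : ∀ m, F₁ m = 0 ↔ F₂ m = 0)
    (hl : ∀ b : B, ∃ l : M → M, ∀ m, F₁ (l m) = b • F₁ m ∧ F₂ (l m) = b • F₂ m)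
    (hr : ∀ b : B, ∃ r : M → M, ∀ m, F₁ (r m) = MulOpposite.op b • F₁ m ∧
      F₂ (r m) = MulOpposite.op b • F₂ m) :
    Nonempty (Bimod.Iso E₁ E₂) := by
  have hk : F₁.ker = F₂.ker := by ext m; exact hker m
  let e : E₁.carrier ≃+ E₂.carrier :=
    (QuotientAddGroup.quotientKerEquivOfSurjective F₁ h₁).symm.trans
      ((QuotientAddGroup.quotientAddEquivOfEq hk).trans
        (QuotientAddGroup.quotientKerEquivOfSurjective F₂ h₂))
  have he (m : M) : e (F₁ m) = F₂ m := by
    have : (QuotientAddGroup.quotientKerEquivOfSurjective F₁ h₁).symm (F₁ m) =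
        (QuotientAddGroup.mk m : M ⧸ F₁.ker) := by
      rw [AddEquiv.symm_apply_eq]; rfl
    change (QuotientAddGroup.quotientKerEquivOfSurjective F₂ h₂)
      ((QuotientAddGroup.quotientAddEquivOfEq hk)
        ((QuotientAddGroup.quotientKerEquivOfSurjective F₁ h₁).symm (F₁ m))) = _
    rw [this]; rfl
  refine ⟨⟨e, fun b x => ?_, fun b x => ?_⟩⟩
  · obtain ⟨m, rfl⟩ := h₁ x
    obtain ⟨l, hl⟩ := hl b
    rw [← (hl m).1, he, he, (hl m).2]
  · obtain ⟨m, rfl⟩ := h₁ x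
    obtain ⟨r, hr⟩ := hr b
    rw [← (hr m).1, he, he, (hr m).2]

end Cover

section Sandwich

open Abelian

variable {C : Type u₁} [Category.{v₁} C] [Abelian C] [HasExt.{u} C]

/-- For classes `x ∈ Ext^i(X, N)` and `y ∈ Ext^j(J, Y)`, the map `f ↦ x · f · y` from
`Hom(N, J)` to `Ext^n(X, Y)`, where `n = i + j`. -/
def sandwich {X N J Y : C} {i j n : ℕ} (x : Ext.{u} X N i) (y : Ext.{u} J Y j) (h : i + j = n) :
    (N ⟶ J) →+ Ext.{u} X Y n where
  toFun f := x.comp ((Ext.mk₀ f).comp y (zero_add j)) h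
  map_zero' := by simp
  map_add' f g := by simp [Ext.mk₀_add, Ext.add_comp, Ext.comp_add]

lemma sandwich_precomp {X N J Y : C} {i j n : ℕ} (x : Ext.{u} X N i) (y : Ext.{u} J Y j)
    (h : i + j = n) (a : X ⟶ X) (a' : N ⟶ N)
    (ha : x.comp (Ext.mk₀ a') (add_zero i) = (Ext.mk₀ a).comp x (zero_add i)) (f : N ⟶ J) :
    sandwich x y h (a' ≫ f) = (Ext.mk₀ a).comp (sandwich x y h f) (zero_add n) := by
  change x.comp ((Ext.mk₀ (a' ≫ f)).comp y (zero_add j)) h =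
    (Ext.mk₀ a).comp (x.comp ((Ext.mk₀ f).comp y (zero_add j)) h) (zero_add n)
  rw [← Ext.mk₀_comp_mk₀_assoc, ← Ext.comp_assoc _ _ _ (add_zero i) (zero_add j) (by lia), ha,
    Ext.comp_assoc _ _ _ (zero_add i) h (by lia)]

lemma sandwich_postcomp {X N J Y : C} {i j n : ℕ} (x : Ext.{u} X N i) (y : Ext.{u} J Y j)
    (h : i + j = n) (c : Y ⟶ Y) (c' : J ⟶ J)
    (hc : y.comp (Ext.mk₀ c) (add_zero j) = (Ext.mk₀ c').comp y (zero_add j)) (f : N ⟶ J) :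
    sandwich x y h (f ≫ c') = (sandwich x y h f).comp (Ext.mk₀ c) (add_zero n) := by
  change x.comp ((Ext.mk₀ (f ≫ c')).comp y (zero_add j)) h =
    (x.comp ((Ext.mk₀ f).comp y (zero_add j)) h).comp (Ext.mk₀ c) (add_zero n)
  rw [← Ext.mk₀_comp_mk₀_assoc, ← hc, Ext.comp_assoc _ _ _ h (add_zero j) (by lia),
    Ext.comp_assoc _ _ _ (zero_add j) (add_zero j) (by lia)]

/-- The morphisms `N₁ ⟶ J₁` which are a sum of a morphism that extends along `d : N₁ ⟶ N₀` and a
morphism that lifts along `q : J₀ ⟶ J₁`. -/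
def Decomposes {N₁ N₀ J₀ J₁ : C} (d : N₁ ⟶ N₀) (q : J₀ ⟶ J₁) (f : N₁ ⟶ J₁) : Prop :=
  ∃ (g : N₀ ⟶ J₁) (h : N₁ ⟶ J₀), f = d ≫ g + h ≫ q

omit [HasExt.{u} C] in
/-- The decomposability of a morphism can be tested after transport along maps of groups of morphisms
which are compatible with `d` and `q`. -/
lemma decomposes_iff {D : Type u₂} [Category.{v₂} D] [Abelian D] {N₁ N₀ J₀ J₁ : C}
    {N₁' N₀' J₀' J₁' : D} {d : N₁ ⟶ N₀} {q : J₀ ⟶ J₁} {d' : N₁' ⟶ N₀'} {q' : J₀' ⟶ J₁'}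
    (e : (N₁ ⟶ J₁) →+ (N₁' ⟶ J₁')) (e₀ : (N₀ ⟶ J₁) → (N₀' ⟶ J₁'))
    (e₁ : (N₁ ⟶ J₀) → (N₁' ⟶ J₀')) (he : Function.Injective e) (he₀ : Function.Surjective e₀)
    (he₁ : Function.Surjective e₁) (hd : ∀ g, e (d ≫ g) = d' ≫ e₀ g)
    (hq : ∀ h, e (h ≫ q) = e₁ h ≫ q') (f : N₁ ⟶ J₁) :
    Decomposes d' q' (e f) ↔ Decomposes d q f := by
  constructor
  · rintro ⟨g', h', e'⟩
    obtain ⟨g, rfl⟩ := he₀ g'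
    obtain ⟨h, rfl⟩ := he₁ h'
    refine ⟨g, h, he ?_⟩
    rw [e', map_add, hd, hq]
  · rintro ⟨g, h, rfl⟩
    exact ⟨e₀ g, e₁ h, by rw [map_add, hd, hq]⟩

lemma mk₀_surjective {X Y : C} (x : Ext.{u} X Y 0) : ∃ f : X ⟶ Y, Ext.mk₀ f = x :=
  ⟨Ext.addEquiv₀ x, Ext.mk₀_addEquiv₀_apply x⟩

section Injective

variable {t N₁ N₀ : C} (ι : t ⟶ N₁) (d : N₁ ⟶ N₀) (hι : ι ≫ d = 0)
  (hex : (ShortComplex.mk ι d hι).Exact) [Mono ι]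
  {S : ShortComplex C} (hS : S.ShortExact) [Injective S.X₂] [Injective S.X₃]

/-- By the injectivity of `S.X₃`, every morphism from `t` extends to `N₁`, and by the injectivity of
`S.X₂`, every class in `Ext¹(t, S.X₁)` comes from a morphism to `S.X₃`. -/
lemma surjective_sandwich_of_injective :
    Function.Surjective (sandwich (Ext.mk₀.{u} ι) hS.extClass (zero_add 1)) := by
  intro x
  obtain ⟨x₃, rfl⟩ := Ext.covariant_sequence_exact₁ t hS x
    (Ext.eq_zero_of_injective _) (zero_add 1)
  obtain ⟨f, rfl⟩ := mk₀_surjective x₃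
  refine ⟨Injective.factorThru f ι, ?_⟩
  change (Ext.mk₀ ι).comp ((Ext.mk₀ _).comp hS.extClass (zero_add 1)) (zero_add 1) = _
  rw [Ext.mk₀_comp_mk₀_assoc, Injective.comp_factorThru]

include hex in
/-- If `ι · f · e = 0`, then `ι ≫ f` lifts to `S.X₂`, and such a lift extends to `N₁`. The difference
of `f` and the resulting morphism vanishes on `t`, so it extends along `d`. -/
lemma sandwich_eq_zero_iff_of_injective (f : N₁ ⟶ S.X₃) :
    sandwich (Ext.mk₀.{u} ι) hS.extClass (zero_add 1) f = 0 ↔ Decomposes d S.g f := by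
  have := hS.epi_g
  have hF : sandwich (Ext.mk₀.{u} ι) hS.extClass (zero_add 1) f =
      (Ext.mk₀ (ι ≫ f)).comp hS.extClass (zero_add 1) := by
    change (Ext.mk₀ ι).comp ((Ext.mk₀ _).comp hS.extClass (zero_add 1)) (zero_add 1) = _
    rw [Ext.mk₀_comp_mk₀_assoc]
  rw [hF]
  constructor
  · intro h
    obtain ⟨x₂, hx₂⟩ := Ext.covariant_sequence_exact₃ t hS _ (zero_add 1) h
    obtain ⟨g, rfl⟩ := mk₀_surjective x₂
    rw [Ext.mk₀_comp_mk₀] at hx₂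
    have hg : g ≫ S.g = ι ≫ f := (Ext.mk₀_bijective _ _).1 hx₂
    let g' : N₁ ⟶ S.X₂ := Injective.factorThru g ι
    have h0 : ι ≫ (f - g' ≫ S.g) = 0 := by
      rw [Preadditive.comp_sub, ← Category.assoc, Injective.comp_factorThru, hg, sub_self]
    refine ⟨hex.descToInjective (f - g' ≫ S.g) h0, g', ?_⟩
    have := hex.comp_descToInjective (f - g' ≫ S.g) h0
    dsimp at this
    rw [this, sub_add_cancel]
  · rintro ⟨g, h, rfl⟩
    rw [Preadditive.comp_add, ← Category.assoc, hι, Limits.zero_comp, zero_add, ← Category.assoc,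
      ← Ext.mk₀_comp_mk₀_assoc, hS.comp_extClass, Ext.comp_zero]

end Injective

section Projective

variable {t J₀ J₁ : C} (q : J₀ ⟶ J₁) (π : J₁ ⟶ t) (hπ : q ≫ π = 0)
  (hex : (ShortComplex.mk q π hπ).Exact) [Epi π]
  {S : ShortComplex C} (hS : S.ShortExact) [Projective S.X₁] [Projective S.X₂]

/-- The dual of `surjective_sandwich_of_injective`. -/
lemma surjective_sandwich_of_projective :
    Function.Surjective (sandwich hS.extClass (Ext.mk₀.{u} π) (add_zero 1)) := by
  intro x
  obtain ⟨x₁, rfl⟩ := Ext.contravariant_sequence_exact₃ hS t x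
    (Ext.eq_zero_of_projective _) (add_zero 1)
  obtain ⟨f, rfl⟩ := mk₀_surjective x₁
  refine ⟨Projective.factorThru f π, ?_⟩
  change hS.extClass.comp ((Ext.mk₀ _).comp (Ext.mk₀ π) (zero_add 0)) (add_zero 1) = _
  rw [Ext.mk₀_comp_mk₀, Projective.factorThru_comp]

include hex in
/-- The dual of `sandwich_eq_zero_iff_of_injective`. -/
lemma sandwich_eq_zero_iff_of_projective (f : S.X₁ ⟶ J₁) :
    sandwich hS.extClass (Ext.mk₀.{u} π) (add_zero 1) f = 0 ↔ Decomposes S.f q f := by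
  have hF : sandwich hS.extClass (Ext.mk₀.{u} π) (add_zero 1) f =
      hS.extClass.comp (Ext.mk₀ (f ≫ π)) (add_zero 1) := by
    change hS.extClass.comp ((Ext.mk₀ _).comp (Ext.mk₀ π) (zero_add 0)) (add_zero 1) = _
    rw [Ext.mk₀_comp_mk₀]
  rw [hF]
  constructor
  · intro h
    obtain ⟨x₂, hx₂⟩ := Ext.contravariant_sequence_exact₁ hS t _ (add_zero 1) h
    obtain ⟨g, rfl⟩ := mk₀_surjective x₂
    rw [Ext.mk₀_comp_mk₀] at hx₂
    have hg : S.f ≫ g = f ≫ π := (Ext.mk₀_bijective _ _).1 hx₂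
    let g' : S.X₂ ⟶ J₁ := Projective.factorThru g π
    have h0 : (f - S.f ≫ g') ≫ π = 0 := by
      rw [Preadditive.sub_comp, Category.assoc, Projective.factorThru_comp, hg, sub_self]
    refine ⟨g', hex.liftFromProjective (f - S.f ≫ g') h0, ?_⟩
    have := hex.liftFromProjective_comp (f - S.f ≫ g') h0
    dsimp at this
    rw [this, add_sub_cancel]
  · rintro ⟨g, h, rfl⟩
    rw [Preadditive.add_comp, Category.assoc, Category.assoc, hπ, Limits.comp_zero, add_zero,
      ← Ext.mk₀_comp_mk₀, hS.extClass_comp_assoc]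

end Projective

section TwoStep

variable {S S' : ShortComplex C} (hS : S.ShortExact) (hS' : S'.ShortExact)

/-- The map `f ↦ e · f · e'` into `Ext²`, for the classes `e`, `e'` of two short exact sequences, is
surjective if the relevant higher extension groups vanish. -/
lemma surjective_sandwich_of_ext_vanishing (h₁ : Subsingleton (Ext.{u} S.X₁ S'.X₂ 1))
    (h₂ : Subsingleton (Ext.{u} S.X₂ S'.X₁ 2)) :
    Function.Surjective (sandwich hS.extClass hS'.extClass (show 1 + 1 = 2 from rfl)) := by
  intro x
  obtain ⟨x₁, rfl⟩ := Ext.contravariant_sequence_exact₃ hS S'.X₁ x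
    (Subsingleton.elim _ _) (show 1 + 1 = 2 from rfl)
  obtain ⟨x₀, rfl⟩ := Ext.covariant_sequence_exact₁ S.X₁ hS' x₁
    (Subsingleton.elim _ _) (zero_add 1)
  obtain ⟨f, rfl⟩ := mk₀_surjective x₀
  exact ⟨f, rfl⟩

lemma sandwich_eq_zero_iff_of_ext_vanishing (h₁ : Subsingleton (Ext.{u} S.X₂ S'.X₂ 1))
    (f : S.X₁ ⟶ S'.X₃) :
    sandwich hS.extClass hS'.extClass (show 1 + 1 = 2 from rfl) f = 0 ↔
      Decomposes S.f S'.g f := by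
  constructor
  · intro h
    obtain ⟨y, hy⟩ := Ext.contravariant_sequence_exact₁ hS S'.X₁ _ (show 1 + 1 = 2 from rfl) h
    obtain ⟨y₀, rfl⟩ := Ext.covariant_sequence_exact₁ S.X₂ hS' y
      (Subsingleton.elim _ _) (zero_add 1)
    obtain ⟨g, rfl⟩ := mk₀_surjective y₀
    rw [Ext.mk₀_comp_mk₀_assoc] at hy
    have h0 : (Ext.mk₀ (f - S.f ≫ g)).comp hS'.extClass (zero_add 1) = 0 := by
      rw [sub_eq_add_neg, Ext.mk₀_add, Ext.mk₀_neg, Ext.add_comp, Ext.neg_comp, hy,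
        add_neg_cancel]
    obtain ⟨z, hz⟩ := Ext.covariant_sequence_exact₃ S.X₁ hS' _ (zero_add 1) h0
    obtain ⟨k, rfl⟩ := mk₀_surjective z
    rw [Ext.mk₀_comp_mk₀] at hz
    have hk : k ≫ S'.g = f - S.f ≫ g := (Ext.mk₀_bijective _ _).1 hz
    exact ⟨g, k, by rw [hk, add_sub_cancel]⟩
  · rintro ⟨g, k, rfl⟩
    change hS.extClass.comp ((Ext.mk₀ _).comp hS'.extClass (zero_add 1)) rfl = 0
    rw [Ext.mk₀_add, Ext.add_comp, ← Ext.mk₀_comp_mk₀_assoc, ← Ext.mk₀_comp_mk₀_assoc,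
      hS'.comp_extClass, Ext.comp_zero, add_zero, hS.extClass_comp_assoc]

end TwoStep

omit [HasExt.{u} C] in
/-- An endomorphism of the right term of a short exact sequence with projective middle term extends
to an endomorphism of the sequence. -/
lemma exists_lift_endomorphism {S : ShortComplex C} (hS : S.ShortExact) [Projective S.X₂]
    (β : S.X₃ ⟶ S.X₃) : ∃ φ : S ⟶ S, φ.τ₃ = β := by
  have := hS.mono_f
  have := hS.epi_g
  let φ₂ : S.X₂ ⟶ S.X₂ := Projective.factorThru (S.g ≫ β) S.g
  have h2 : φ₂ ≫ S.g = S.g ≫ β := Projective.factorThru_comp _ _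
  have h1 : (S.f ≫ φ₂) ≫ S.g = 0 := by
    rw [Category.assoc, h2, ← Category.assoc, S.zero, Limits.zero_comp]
  exact ⟨⟨hS.exact.lift _ h1, φ₂, β, hS.exact.lift_f _ h1, h2⟩, rfl⟩

end Sandwich

/-! ### The duality over a semisimple central subring -/

lemma shortExact_moduleCat {R : Type u} [Ring R] (S : ShortComplex (ModuleCat.{u} R))
    (hf : Function.Injective S.f) (hex : ∀ x : S.X₂, S.g x = 0 → ∃ y, S.f y = x)
    (hg : Function.Surjective S.g) : S.ShortExact :=
  ShortComplex.ShortExact.mk' ((ShortComplex.moduleCat_exact_iff S).2 hex)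
    ((ModuleCat.mono_iff_injective _).2 hf) ((ModuleCat.epi_iff_surjective _).2 hg)

section SemisimpleDual

variable {K : Type u} [CommRing K] [IsSemisimpleRing K]

/-- Over a semisimple commutative ring, a linear form which vanishes on the kernel of `ψ` factors
through `ψ`: the ring is an injective module over itself. -/
lemma exists_linearForm_comp_eq {V W : Type u} [AddCommGroup V] [AddCommGroup W] [Module K V]
    [Module K W] (ψ : V →ₗ[K] W) (f : V →ₗ[K] K) (h : ∀ x, ψ x = 0 → f x = 0) :
    ∃ g : W →ₗ[K] K, ∀ x, g (ψ x) = f x := by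
  have hinj : Module.Injective K K := Module.injective_of_isSemisimpleRing K K
  have hle : LinearMap.ker ψ ≤ LinearMap.ker f := fun x hx => h x hx
  obtain ⟨g, hg⟩ := hinj.out ((LinearMap.ker ψ).liftQ ψ le_rfl)
    (LinearMap.ker_eq_bot.1 (Submodule.ker_liftQ_eq_bot' _ _ rfl))
    ((LinearMap.ker ψ).liftQ f hle)
  exact ⟨g, fun x => hg (Submodule.Quotient.mk x)⟩

lemma eq_of_forall_linearForm {V : Type u} [AddCommGroup V] [Module K V] {x y : V}
    (h : ∀ f : V →ₗ[K] K, f x = f y) : x = y := by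
  have := Module.projective_of_isSemisimpleRing K V
  rw [← sub_eq_zero, ← Module.forall_dual_apply_eq_zero_iff K]
  intro f
  rw [map_sub, h, sub_self]

/-- On a finitely generated module over a semisimple commutative ring, every linear form on the
dual is the evaluation at an element. -/
lemma exists_eval_eq {V : Type u} [AddCommGroup V] [Module K V] [Module.Finite K V]
    (F : (V →ₗ[K] K) →ₗ[K] K) : ∃ x : V, ∀ f : V →ₗ[K] K, f x = F f := by
  have := Module.projective_of_isSemisimpleRing K V
  obtain ⟨x, hx⟩ := (Module.evalEquiv K V).surjective F
  exact ⟨x, fun f => by rw [← hx]; rfl⟩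

end SemisimpleDual

section Dual

variable (K : Type u) [CommRing K] (R : Type u) [Ring R] [Algebra K R]

/-- The `K`-module underlying an `R`-module, for a `K`-algebra `R`. -/
abbrev Res (M : ModuleCat.{u} R) : ModuleCat.{u} K :=
  (ModuleCat.restrictScalars (algebraMap K R)).obj M

/-- The `K`-linear map underlying a morphism of `R`-modules. -/
abbrev resMap {M N : ModuleCat.{u} R} (φ : M ⟶ N) : Res K R M →ₗ[K] Res K R N :=
  ((ModuleCat.restrictScalars (algebraMap K R)).map φ).hom

lemma finite_res [Module.Finite K R] (M : ModuleCat.{u} R) [Module.Finite R M] :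
    Module.Finite K (Res K R M) := by
  let _ : Module K M := Module.compHom M (algebraMap K R)
  have : IsScalarTower K R M := IsScalarTower.of_algebraMap_smul fun _ _ => rfl
  exact Module.Finite.trans (R := K) R M

lemma finite_of_finite_res (M : ModuleCat.{u} R) [h : Module.Finite K (Res K R M)] :
    Module.Finite R M := by
  let _ : Module K M := Module.compHom M (algebraMap K R)
  have : IsScalarTower K R M := IsScalarTower.of_algebraMap_smul fun _ _ => rfl
  have : Module.Finite K M := h
  exact Module.Finite.of_restrictScalars_finite K R M

variable {R}

/-- A linear form on the `K`-module underlying an `R`-module. -/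
def mkDual {M : ModuleCat.{u} R} (f : M →+ K)
    (hf : ∀ (c : K) (x : M), f (algebraMap K R c • x) = c * f x) : DualCarrier K R M where
  toFun x := f x
  map_add' x y := map_add f x y
  map_smul' c x := hf c x

lemma dualCarrier_algebraMap_smul {M : ModuleCat.{u} R} (f : DualCarrier K R M) (c : K) (x : M) :
    f (algebraMap K R c • x : M) = c * f x := f.map_smul' c x

lemma dualCarrier_add {M : ModuleCat.{u} R} (f : DualCarrier K R M) (x y : M) :
    f (x + y : M) = f x + f y := map_add f x y

end Dual

section DualLeft

variable (K : Type u) [CommRing K] (A : Type u) [Ring A] [Algebra K A]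

/-- The duality `D = Hom_K(-, K)` from right `A`-modules to left `A`-modules. -/
abbrev dualLeft : (ModuleCat.{u} Aᵐᵒᵖ)ᵒᵖ ⥤ ModuleCat.{u} A := dual K Aᵐᵒᵖ ⋙ ofOpOp A

variable {K A}

/-- The linear form given by an element of `D Q`. -/
abbrev toForm {Q : ModuleCat.{u} Aᵐᵒᵖ} (ξ : (dualLeft K A).obj (op Q)) : DualCarrier K Aᵐᵒᵖ Q := ξ

/-- The element of `D Q` given by a linear form. -/
abbrev ofForm {Q : ModuleCat.{u} Aᵐᵒᵖ} (ξ : DualCarrier K Aᵐᵒᵖ Q) : (dualLeft K A).obj (op Q) := ξ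

/-- The linear form given by an element of the right module `D X`. -/
abbrev toFormR {X : ModuleCat.{u} A} (ξ : (dual K A).obj (op X)) : DualCarrier K A X := ξ

/-- The element of the right module `D X` given by a linear form. -/
abbrev ofFormR {X : ModuleCat.{u} A} (ξ : DualCarrier K A X) : (dual K A).obj (op X) := ξ

lemma dualLeft_ext {Q : ModuleCat.{u} Aᵐᵒᵖ} {ξ η : (dualLeft K A).obj (op Q)}
    (h : ∀ x : Q, toForm ξ x = toForm η x) : ξ = η := LinearMap.ext h

lemma dual_ext {X : ModuleCat.{u} A} {ξ η : (dual K A).obj (op X)}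
    (h : ∀ x : X, toFormR ξ x = toFormR η x) : ξ = η := LinearMap.ext h

/-- The adjunction between the two dualities: a morphism of right modules `Q → D X` is the same as
a pairing of `X` with `Q`, which is the same as a morphism of left modules `X → D Q`. -/
def dualFlip {Q : ModuleCat.{u} Aᵐᵒᵖ} {X : ModuleCat.{u} A} (p : Q ⟶ (dual K A).obj (op X)) :
    X ⟶ (dualLeft K A).obj (op Q) :=
  ModuleCat.ofHom (Y := (dualLeft K A).obj (op Q))
    { toFun := fun x => ofForm (mkDual K
        { toFun := fun q => toFormR (p q) x
          map_zero' := by rw [map_zero]; rfl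
          map_add' := fun q q' => by rw [map_add]; rfl }
        (fun c q => by
          change toFormR (p (algebraMap K Aᵐᵒᵖ c • q)) x = c * toFormR (p q) x
          rw [map_smul]
          exact dualCarrier_algebraMap_smul K (toFormR (p q)) c x))
      map_add' := fun x y => dualLeft_ext fun q => dualCarrier_add K (toFormR (p q)) x y
      map_smul' := fun a x => dualLeft_ext fun q => by
        change toFormR (p q) (a • x) = toFormR (p (MulOpposite.op a • q)) x
        rw [map_smul]; rfl }

/-- The inverse of `dualFlip`. -/
def dualUnflip {Q : ModuleCat.{u} Aᵐᵒᵖ} {X : ModuleCat.{u} A} (φ : X ⟶ (dualLeft K A).obj (op Q)) :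
    Q ⟶ (dual K A).obj (op X) :=
  ModuleCat.ofHom (Y := (dual K A).obj (op X))
    { toFun := fun q => ofFormR (mkDual K
        { toFun := fun x => toForm (φ x) q
          map_zero' := by rw [map_zero]; rfl
          map_add' := fun q q' => by rw [map_add]; rfl }
        (fun c x => by
          change toForm (φ (algebraMap K A c • x)) q = c * toForm (φ x) q
          rw [map_smul]
          exact dualCarrier_algebraMap_smul K (toForm (φ x)) c q))
      map_add' := fun q q' => dual_ext fun x => dualCarrier_add K (toForm (φ x)) q q'
      map_smul' := fun a q => dual_ext fun x => by
        change toForm (φ x) (a • q) = toForm (φ (a.unop • x)) q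
        rw [map_smul]; rfl }

variable [IsSemisimpleRing K]

lemma dualLeft_exact {S : ShortComplex (ModuleCat.{u} Aᵐᵒᵖ)} (hS : S.Exact) :
    (S.op.map (dualLeft K A)).Exact := by
  rw [ShortComplex.moduleCat_exact_iff] at hS ⊢
  intro ξ hξ
  obtain ⟨g, hg⟩ := exists_linearForm_comp_eq (resMap K Aᵐᵒᵖ S.g) (toForm ξ) (by
    intro x hx
    obtain ⟨y, rfl⟩ := hS x hx
    exact LinearMap.congr_fun (f := toForm ((dualLeft K A).map S.f.op ξ)) (g := 0) hξ y)
  exact ⟨ofForm g, dualLeft_ext hg⟩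

omit [IsSemisimpleRing K] in
lemma mono_dualLeft_map {Q Q' : ModuleCat.{u} Aᵐᵒᵖ} (φ : Q ⟶ Q') [hφ : Epi φ] :
    Mono ((dualLeft K A).map φ.op) := by
  rw [ModuleCat.epi_iff_surjective] at hφ
  rw [ModuleCat.mono_iff_injective]
  intro ξ η h
  refine dualLeft_ext fun x => ?_
  obtain ⟨y, rfl⟩ := hφ x
  exact LinearMap.congr_fun (f := toForm ((dualLeft K A).map φ.op ξ)) h y

lemma epi_dualLeft_map {Q Q' : ModuleCat.{u} Aᵐᵒᵖ} (φ : Q ⟶ Q') [hφ : Mono φ] :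
    Epi ((dualLeft K A).map φ.op) := by
  rw [ModuleCat.mono_iff_injective] at hφ
  rw [ModuleCat.epi_iff_surjective]
  intro ξ
  obtain ⟨g, hg⟩ := exists_linearForm_comp_eq (resMap K Aᵐᵒᵖ φ) (toForm ξ) (by
    intro x hx
    have : x = 0 := hφ (hx.trans (map_zero φ.hom).symm)
    rw [this, map_zero])
  exact ⟨ofForm g, dualLeft_ext hg⟩

lemma epi_dual_map {X Y : ModuleCat.{u} A} (φ : X ⟶ Y) [hφ : Mono φ] :
    Epi ((dual K A).map φ.op) := by
  rw [ModuleCat.mono_iff_injective] at hφ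
  rw [ModuleCat.epi_iff_surjective]
  intro ξ
  obtain ⟨g, hg⟩ := exists_linearForm_comp_eq (resMap K A φ) (toFormR ξ) (by
    intro x hx
    have : x = 0 := hφ (hx.trans (map_zero φ.hom).symm)
    rw [this, map_zero])
  exact ⟨ofFormR g, dual_ext hg⟩

/-- The dual of a projective right module is an injective left module. -/
lemma injective_dualLeft (Q : ModuleCat.{u} Aᵐᵒᵖ) [Projective Q] :
    Injective ((dualLeft K A).obj (op Q)) where
  factors {X Y} φ i _ := by
    have := epi_dual_map (K := K) i
    let l := Projective.factorThru (dualUnflip φ) ((dual K A).map i.op)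
    have hl : l ≫ (dual K A).map i.op = dualUnflip φ := Projective.factorThru_comp _ _
    refine ⟨dualFlip l, ?_⟩
    ext x
    refine dualLeft_ext fun q => ?_
    have h2 := congrArg (fun k : Q ⟶ (dual K A).obj (op X) => toFormR (k q) x) hl
    exact h2

/-- On finitely generated modules, the duality is full. -/
lemma exists_dualLeft_map_eq [Module.Finite K A] {Q V : ModuleCat.{u} Aᵐᵒᵖ} [Module.Finite Aᵐᵒᵖ V]
    (g : (dualLeft K A).obj (op V) ⟶ (dualLeft K A).obj (op Q)) :
    ∃ h : Q ⟶ V, (dualLeft K A).map h.op = g := by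
  have := finite_res K Aᵐᵒᵖ V
  have hex (q : Q) : ∃ v : V, ∀ ξ : (dualLeft K A).obj (op V), toForm ξ v = toForm (g ξ) q := by
    refine exists_eval_eq (K := K) (V := Res K Aᵐᵒᵖ V)
      { toFun := fun ξ => toForm (g (ofForm ξ)) q
        map_add' := fun ξ η => by
          have : g (ofForm ξ + ofForm η) = _ := map_add g.hom (ofForm ξ) (ofForm η)
          exact LinearMap.congr_fun (f := toForm (g (ofForm ξ + ofForm η))) this q
        map_smul' := fun c ξ => ?_ }
    have h1 : ofForm (c • ξ) = algebraMap K A c • ofForm ξ :=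
      dualLeft_ext fun x => (dualCarrier_algebraMap_smul K ξ c x).symm
    have h2 : g (algebraMap K A c • ofForm ξ) = _ :=
      map_smul g.hom (algebraMap K A c) (ofForm ξ)
    rw [h1]
    refine (LinearMap.congr_fun (f := toForm (g (algebraMap K A c • ofForm ξ))) h2 q).trans ?_
    exact dualCarrier_algebraMap_smul K (toForm (g (ofForm ξ))) c q
  choose h hh using hex
  have sep {x y : V} (hxy : ∀ ξ : (dualLeft K A).obj (op V), toForm ξ x = toForm ξ y) : x = y :=
    eq_of_forall_linearForm (V := Res K Aᵐᵒᵖ V) hxy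
  refine ⟨ModuleCat.ofHom
    { toFun := h
      map_add' := fun x y => sep fun ξ => ?_
      map_smul' := fun r x => sep fun ξ => ?_ }, ?_⟩
  · refine ((hh _ _).trans ?_).trans (dualCarrier_add K (toForm ξ) _ _).symm
    rw [hh, hh]
    exact dualCarrier_add K (toForm (g ξ)) _ _
  · have h2 : g (r.unop • ξ) = _ := map_smul g.hom r.unop ξ
    refine (hh _ _).trans ?_
    refine (LinearMap.congr_fun (f := toForm (g (r.unop • ξ))) h2 x).symm.trans ?_
    exact (hh x (r.unop • ξ)).symm
  · ext ξ
    exact dualLeft_ext fun q => hh q ξ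

/-- The duality is faithful. -/
lemma dualLeft_map_injective {Q V : ModuleCat.{u} Aᵐᵒᵖ} {h h' : Q ⟶ V}
    (e : (dualLeft K A).map h.op = (dualLeft K A).map h'.op) : h = h' := by
  ext q
  refine eq_of_forall_linearForm (K := K) (V := Res K Aᵐᵒᵖ V) fun f => ?_
  exact congrArg (fun k : (dualLeft K A).obj (op V) ⟶ (dualLeft K A).obj (op Q) =>
    toForm (k (ofForm f)) q) e

variable (K A)

/-- For a sequence `Q₁ → Q₀ → D T` of right modules, the sequence `T → D Q₀ → D Q₁`. -/
abbrev codualComplex {Q₁ Q₀ : ModuleCat.{u} Aᵐᵒᵖ} {T : ModuleCat.{u} A} (q : Q₁ ⟶ Q₀)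
    (p : Q₀ ⟶ (dual K A).obj (op T)) (h : q ≫ p = 0) : ShortComplex (ModuleCat.{u} A) :=
  ShortComplex.mk (dualFlip p) ((dualLeft K A).map q.op) (by
    ext x
    refine dualLeft_ext fun y => ?_
    exact congrArg (fun k : Q₁ ⟶ (dual K A).obj (op T) => toFormR (k y) x) h)

omit [IsSemisimpleRing K] in
lemma dualCarrier_smul_eq (T : ModuleCat.{u} A) (c : K) (ξ : DualCarrier K A T) :
    c • ξ = algebraMap K Aᵐᵒᵖ c • ξ :=
  LinearMap.ext fun x => (dualCarrier_algebraMap_smul K ξ c x).symm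

/-- By reflexivity of `T`, the `K`-dual of a short exact sequence ending in `D T` is a short exact
sequence starting in `T`. -/
lemma shortExact_codualComplex [Module.Finite K A] {Q₁ Q₀ : ModuleCat.{u} Aᵐᵒᵖ}
    {T : ModuleCat.{u} A} [Module.Finite A T] (q : Q₁ ⟶ Q₀)
    (p : Q₀ ⟶ (dual K A).obj (op T)) (h : q ≫ p = 0) (hS : (ShortComplex.mk q p h).ShortExact) :
    (codualComplex K A q p h).ShortExact := by
  have := finite_res K A T
  have hp : Function.Surjective p := hS.moduleCat_surjective_g
  refine shortExact_moduleCat _ ?_ ?_ ?_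
  swap
  · intro ξ hξ
    have hker (y : Q₀) (hy : p y = 0) : toForm ξ y = 0 := by
      obtain ⟨z, rfl⟩ := (ShortComplex.moduleCat_exact_iff _).1 hS.exact y hy
      exact LinearMap.congr_fun (f := toForm ((dualLeft K A).map q.op ξ)) (g := 0) hξ z
    let p' : Res K Aᵐᵒᵖ Q₀ →ₗ[K] DualCarrier K A T :=
      { toFun := fun y => toFormR (p y)
        map_add' := fun y z => map_add p.hom y z
        map_smul' := fun c y =>
          (map_smul p.hom (algebraMap K Aᵐᵒᵖ c) y).trans
            (dualCarrier_smul_eq K A T c (toFormR (p y))).symm }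
    obtain ⟨F, hF⟩ := exists_linearForm_comp_eq p' (toForm ξ) hker
    obtain ⟨x, hx⟩ := exists_eval_eq F
    refine ⟨x, dualLeft_ext fun y => ?_⟩
    exact (hx (toFormR (p y))).trans (hF y)
  · intro x y hxy
    refine eq_of_forall_linearForm (K := K) (V := Res K A T) fun f => ?_
    obtain ⟨z, hz⟩ := hp (ofFormR f)
    have h1 : toFormR (p z) x = toFormR (p z) y :=
      LinearMap.congr_fun (f := toForm (dualFlip p x)) hxy z
    rw [hz] at h1
    exact h1
  · have : Mono q := hS.mono_f
    exact (ModuleCat.epi_iff_surjective _).1 (epi_dualLeft_map q)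

omit [IsSemisimpleRing K] in
variable {K A} in
/-- Naturality of `dualFlip`. -/
lemma comp_dualFlip {Q Q' : ModuleCat.{u} Aᵐᵒᵖ} {T T' : ModuleCat.{u} A}
    (p : Q ⟶ (dual K A).obj (op T)) (p' : Q' ⟶ (dual K A).obj (op T'))
    (β : T' ⟶ T) (γ : Q ⟶ Q') (h : γ ≫ p' = p ≫ (dual K A).map β.op) :
    β ≫ dualFlip p = dualFlip p' ≫ (dualLeft K A).map γ.op := by
  ext x
  refine dualLeft_ext fun y => ?_
  exact (congrArg (fun k : Q ⟶ (dual K A).obj (op T') => toFormR (k y) x) h).symm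

end DualLeft

section FiniteDual

variable (K : Type u) [CommRing K] [IsSemisimpleRing K] (A : Type u) [Ring A] [Algebra K A]
  [Module.Finite K A]

lemma finite_dual (T : ModuleCat.{u} A) [Module.Finite A T] :
    Module.Finite Aᵐᵒᵖ ((dual K A).obj (op T)) := by
  have := finite_res K A T
  have := Module.projective_of_isSemisimpleRing K (Res K A T)
  let e : Module.Dual K (Res K A T) ≃ₗ[K] Res K Aᵐᵒᵖ ((dual K A).obj (op T)) :=
    { toFun := fun ξ => ξ
      invFun := fun ξ => ξ
      map_add' := fun _ _ => rfl
      map_smul' := fun c ξ => dualCarrier_smul_eq K A T c ξ }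
  have : Module.Finite K (Res K Aᵐᵒᵖ ((dual K A).obj (op T))) := Module.Finite.equiv e
  exact finite_of_finite_res K Aᵐᵒᵖ _

lemma finite_dualLeft (Q : ModuleCat.{u} Aᵐᵒᵖ) [Module.Finite Aᵐᵒᵖ Q] :
    Module.Finite A ((dualLeft K A).obj (op Q)) := by
  have := finite_res K Aᵐᵒᵖ Q
  have := Module.projective_of_isSemisimpleRing K (Res K Aᵐᵒᵖ Q)
  let e : Module.Dual K (Res K Aᵐᵒᵖ Q) ≃ₗ[K] Res K A ((dualLeft K A).obj (op Q)) :=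
    { toFun := fun ξ => ξ
      invFun := fun ξ => ξ
      map_add' := fun _ _ => rfl
      map_smul' := fun c ξ => dualCarrier_smul_eq K Aᵐᵒᵖ Q c ξ }
  have : Module.Finite K (Res K A ((dualLeft K A).obj (op Q))) := Module.Finite.equiv e
  exact finite_of_finite_res K A _

end FiniteDual

/-! ### The functor `Hom(-, R)`, the transpose and the Nakayama functor -/

section Star

variable (R : Type u) [Ring R]

/-- The functor `Hom_R(-, R)` from left `R`-modules to right `R`-modules. -/
def star : (ModuleCat.{u} R)ᵒᵖ ⥤ ModuleCat.{u} Rᵐᵒᵖ where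
  obj M := ModuleCat.of Rᵐᵒᵖ (M.unop →ₗ[R] R)
  map φ := ModuleCat.ofHom
    { toFun := fun f => f ∘ₗ φ.unop.hom
      map_add' := fun _ _ => rfl
      map_smul' := fun _ _ => rfl }

instance : (star R).Additive where
  map_add {M N φ ψ} := by
    ext f
    refine LinearMap.ext fun x => ?_
    exact map_add (show M.unop →ₗ[R] R from f) _ _

variable {R}

lemma star_ext {M : ModuleCat.{u} R} {f g : (star R).obj (op M)}
    (h : ∀ x : M, (show M →ₗ[R] R from f) x = (show M →ₗ[R] R from g) x) : f = g :=
  LinearMap.ext h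

/-- The connecting homomorphism `Hom_R(X₁, R) → Ext¹_R(X₃, R)` of a short exact sequence, as a
morphism of right modules. -/
def starConnecting {S : ShortComplex (ModuleCat.{u} R)} (hS : S.ShortExact) :
    (star R).obj (op S.X₁) ⟶ (transpose R).obj (op S.X₃) :=
  letI := extRightModule 1 S.X₃ (ModuleCat.of R R) (actHom R Rᵐᵒᵖ R)
  ModuleCat.ofHom (Y := Abelian.Ext.{u} S.X₃ (ModuleCat.of R R) 1)
    { toFun := fun f => hS.extClass.comp
        (Abelian.Ext.mk₀ (ModuleCat.ofHom (show S.X₁ →ₗ[R] R from f))) (add_zero 1)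
      map_add' := fun f g => by
        have : ModuleCat.ofHom (show S.X₁ →ₗ[R] R from f + g) =
          ModuleCat.ofHom (show S.X₁ →ₗ[R] R from f) +
            ModuleCat.ofHom (show S.X₁ →ₗ[R] R from g) := rfl
        rw [this, Abelian.Ext.mk₀_add, Abelian.Ext.comp_add]
      map_smul' := fun r f => by
        change _ = (hS.extClass.comp (Abelian.Ext.mk₀
          (ModuleCat.ofHom (show S.X₁ →ₗ[R] R from f))) (add_zero 1)).comp
          (Abelian.Ext.mk₀ (actHom R Rᵐᵒᵖ R r)) (add_zero 1)
        rw [Abelian.Ext.comp_assoc _ _ _ (add_zero 1) (add_zero 0) (by lia),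
          Abelian.Ext.mk₀_comp_mk₀]
        rfl }

lemma star_comp_starConnecting {S : ShortComplex (ModuleCat.{u} R)} (hS : S.ShortExact) :
    (star R).map S.f.op ≫ starConnecting hS = 0 := by
  ext f
  change hS.extClass.comp (Abelian.Ext.mk₀ (S.f ≫ ModuleCat.ofHom (show S.X₂ →ₗ[R] R from f)))
    (add_zero 1) = 0
  rw [← Abelian.Ext.mk₀_comp_mk₀, hS.extClass_comp_assoc]

lemma exact_starConnecting {S : ShortComplex (ModuleCat.{u} R)} (hS : S.ShortExact) :
    (ShortComplex.mk ((star R).map S.f.op) (starConnecting hS)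
      (star_comp_starConnecting hS)).Exact := by
  rw [ShortComplex.moduleCat_exact_iff]
  intro f hf
  obtain ⟨x, hx⟩ := Abelian.Ext.contravariant_sequence_exact₁ hS (ModuleCat.of R R)
    (Abelian.Ext.mk₀ (ModuleCat.ofHom (show S.X₁ →ₗ[R] R from f))) (add_zero 1) hf
  obtain ⟨g, rfl⟩ := mk₀_surjective x
  rw [Abelian.Ext.mk₀_comp_mk₀] at hx
  refine ⟨g.hom, ?_⟩
  exact congrArg ModuleCat.Hom.hom ((Abelian.Ext.mk₀_bijective _ _).1 hx)

lemma epi_starConnecting {S : ShortComplex (ModuleCat.{u} R)} (hS : S.ShortExact)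
    [Projective S.X₂] : Epi (starConnecting hS) := by
  rw [ModuleCat.epi_iff_surjective]
  intro x
  obtain ⟨y, hy⟩ := Abelian.Ext.contravariant_sequence_exact₃ hS (ModuleCat.of R R)
    (show Abelian.Ext.{u} S.X₃ (ModuleCat.of R R) 1 from x)
    (Abelian.Ext.eq_zero_of_projective _) (add_zero 1)
  obtain ⟨g, rfl⟩ := mk₀_surjective y
  exact ⟨g.hom, hy⟩

lemma starConnecting_naturality {S : ShortComplex (ModuleCat.{u} R)} (hS : S.ShortExact)
    (φ : S ⟶ S) :
    (star R).map φ.τ₁.op ≫ starConnecting hS = starConnecting hS ≫ (transpose R).map φ.τ₃.op := by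
  ext f
  change hS.extClass.comp
      (Abelian.Ext.mk₀ (φ.τ₁ ≫ ModuleCat.ofHom (show S.X₁ →ₗ[R] R from f))) (add_zero 1) =
    (Abelian.Ext.mk₀ φ.τ₃).comp (hS.extClass.comp (Abelian.Ext.mk₀
      (ModuleCat.ofHom (show S.X₁ →ₗ[R] R from f))) (add_zero 1)) (zero_add 1)
  rw [← Abelian.Ext.mk₀_comp_mk₀,
    ← Abelian.Ext.comp_assoc _ _ _ (add_zero 1) (add_zero 0) (by lia),
    hS.extClass_naturality hS φ, Abelian.Ext.comp_assoc _ _ _ (zero_add 1) (add_zero 1) (by lia)]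

/-- The regular module as a module over the opposite ring is free: both structures on the right
module `R` agree. -/
def opSelfEquiv : R ≃ₗ[Rᵐᵒᵖ] Rᵐᵒᵖ where
  toFun := MulOpposite.op
  invFun := MulOpposite.unop
  map_add' _ _ := rfl
  map_smul' _ _ := rfl

lemma projective_star_free (n : ℕ) :
    Projective ((star R).obj (op (ModuleCat.of R (Fin n → R)))) := by
  rw [← IsProjective.iff_projective]
  have e : ((Fin n → R) →ₗ[R] R) ≃ₗ[Rᵐᵒᵖ] (Fin n → Rᵐᵒᵖ) :=
    (LinearEquiv.piRing R R (Fin n) Rᵐᵒᵖ).trans (LinearEquiv.piCongrRight fun _ => opSelfEquiv)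
  exact Module.Projective.of_equiv e.symm

lemma finite_star_free (n : ℕ) :
    Module.Finite Rᵐᵒᵖ ((star R).obj (op (ModuleCat.of R (Fin n → R)))) := by
  have e : ((Fin n → R) →ₗ[R] R) ≃ₗ[Rᵐᵒᵖ] (Fin n → Rᵐᵒᵖ) :=
    (LinearEquiv.piRing R R (Fin n) Rᵐᵒᵖ).trans (LinearEquiv.piCongrRight fun _ => opSelfEquiv)
  exact Module.Finite.equiv e.symm

lemma exists_retract_free (P : ModuleCat.{u} R) [Module.Finite R P] [hP : Projective P] :
    ∃ n : ℕ, Nonempty (Retract P (ModuleCat.of R (Fin n → R))) := by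
  obtain ⟨n, f, hf⟩ := Module.Finite.exists_fin' R P
  have : Epi (ModuleCat.ofHom f) := (ModuleCat.epi_iff_surjective _).2 hf
  exact ⟨n, ⟨⟨Projective.factorThru (𝟙 P) (ModuleCat.ofHom f), ModuleCat.ofHom f,
    Projective.factorThru_comp _ _⟩⟩⟩

lemma projective_star (P : ModuleCat.{u} R) [Module.Finite R P] [Projective P] :
    Projective ((star R).obj (op P)) := by
  obtain ⟨n, ⟨r⟩⟩ := exists_retract_free P
  have := projective_star_free (R := R) n
  exact (r.op.map (star R)).projective

lemma finite_star (P : ModuleCat.{u} R) [Module.Finite R P] [Projective P] :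
    Module.Finite Rᵐᵒᵖ ((star R).obj (op P)) := by
  obtain ⟨n, ⟨r⟩⟩ := exists_retract_free P
  have := finite_star_free (R := R) n
  refine Module.Finite.of_surjective ((star R).map r.i.op).hom fun f => ?_
  refine ⟨(star R).map r.r.op f, ?_⟩
  rw [← ModuleCat.comp_apply, ← Functor.map_comp, ← op_comp, r.retract, op_id,
    CategoryTheory.Functor.map_id]
  rfl

/-- A finitely generated module over a Noetherian ring has a presentation `0 → X₁ → Rⁿ → M → 0`
with `X₁` finitely generated. -/
lemma exists_presentation [IsNoetherianRing R] (M : ModuleCat.{u} R) [Module.Finite R M] :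
    ∃ (X₁ X₀ : ModuleCat.{u} R) (i : X₁ ⟶ X₀) (p : X₀ ⟶ M) (h : i ≫ p = 0),
      (ShortComplex.mk i p h).ShortExact ∧ Projective X₀ ∧ Module.Finite R X₀ ∧
        Module.Finite R X₁ := by
  obtain ⟨n, f, hf⟩ := Module.Finite.exists_fin' R M
  refine ⟨ModuleCat.of R (LinearMap.ker f), ModuleCat.of R (Fin n → R),
    ModuleCat.ofHom (LinearMap.ker f).subtype, ModuleCat.ofHom f, ?_,
    shortExact_moduleCat _ Subtype.val_injective (fun x hx => ⟨⟨x, hx⟩, rfl⟩) hf, ?_, ?_, ?_⟩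
  · ext x; exact x.2
  · rw [← IsProjective.iff_projective]
    change Module.Projective R (Fin n → R)
    infer_instance
  · change Module.Finite R (Fin n → R)
    infer_instance
  · change Module.Finite R (LinearMap.ker f)
    infer_instance

end Star

section Nakayama

variable (K : Type u) [CommRing K] (A : Type u) [Ring A] [Algebra K A]

/-- The Nakayama functor `ν = D Hom_A(-, A)`. -/
abbrev nakayama : ModuleCat.{u} A ⥤ ModuleCat.{u} A := (star A).rightOp ⋙ dualLeft K A

/-- The functor `Q ↦ Hom(Q, A)` from right `A`-modules to left `A`-modules. -/
abbrev starRight : (ModuleCat.{u} Aᵐᵒᵖ)ᵒᵖ ⥤ ModuleCat.{u} A := star Aᵐᵒᵖ ⋙ ofOpOp A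

variable {K A}

/-- A morphism `P → Hom(Q, A)` is a bilinear pairing `P × Q → A`, hence a morphism
`Q → Hom(P, A)`. -/
def starFlip {P : ModuleCat.{u} A} {Q : ModuleCat.{u} Aᵐᵒᵖ} (f : P ⟶ (starRight A).obj (op Q)) :
    Q ⟶ (star A).obj (op P) :=
  ModuleCat.ofHom (Y := (star A).obj (op P))
    { toFun := fun q =>
        (show P →ₗ[A] A from
        { toFun := fun x => ((show Q →ₗ[Aᵐᵒᵖ] Aᵐᵒᵖ from f x) q).unop
          map_add' := fun x y => by rw [map_add]; rfl
          map_smul' := fun a x => by rw [map_smul]; rfl })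
      map_add' := fun q q' => star_ext fun x =>
        congrArg MulOpposite.unop (map_add (show Q →ₗ[Aᵐᵒᵖ] Aᵐᵒᵖ from f x) q q')
      map_smul' := fun a q => star_ext fun x =>
        congrArg MulOpposite.unop (map_smul (show Q →ₗ[Aᵐᵒᵖ] Aᵐᵒᵖ from f x) a q) }

/-- The inverse of `starFlip`. -/
def starUnflip {P : ModuleCat.{u} A} {Q : ModuleCat.{u} Aᵐᵒᵖ} (g : Q ⟶ (star A).obj (op P)) :
    P ⟶ (starRight A).obj (op Q) :=
  ModuleCat.ofHom (Y := (starRight A).obj (op Q))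
    { toFun := fun x =>
        (show Q →ₗ[Aᵐᵒᵖ] Aᵐᵒᵖ from
        { toFun := fun q => MulOpposite.op ((show P →ₗ[A] A from g q) x)
          map_add' := fun q q' => by rw [map_add]; rfl
          map_smul' := fun a q => by rw [map_smul]; rfl })
      map_add' := fun x y => star_ext (R := Aᵐᵒᵖ) (M := Q) fun q =>
        congrArg MulOpposite.op (map_add (show P →ₗ[A] A from g q) x y)
      map_smul' := fun a x => star_ext (R := Aᵐᵒᵖ) (M := Q) fun q =>
        congrArg MulOpposite.op (map_smul (show P →ₗ[A] A from g q) a x) }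

variable (K) in
/-- The map `Hom_A(P, Hom(Q, A)) → Hom_A(ν P, D Q)`. -/
def nakayamaHom (P : ModuleCat.{u} A) (Q : ModuleCat.{u} Aᵐᵒᵖ) :
    (P ⟶ (starRight A).obj (op Q)) →+ ((nakayama K A).obj P ⟶ (dualLeft K A).obj (op Q)) where
  toFun f := (dualLeft K A).map (starFlip f).op
  map_zero' := by
    have : starFlip (0 : P ⟶ (starRight A).obj (op Q)) = 0 := rfl
    rw [this]
    exact (dualLeft K A).map_zero _ _
  map_add' f g := by
    have : starFlip (f + g) = starFlip f + starFlip g := rfl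
    rw [this, op_add, Functor.map_add]

lemma nakayamaHom_precomp {P P' : ModuleCat.{u} A} {Q : ModuleCat.{u} Aᵐᵒᵖ} (φ : P' ⟶ P)
    (f : P ⟶ (starRight A).obj (op Q)) :
    nakayamaHom K P' Q (φ ≫ f) = (nakayama K A).map φ ≫ nakayamaHom K P Q f := rfl

lemma nakayamaHom_postcomp {P : ModuleCat.{u} A} {Q Q' : ModuleCat.{u} Aᵐᵒᵖ} (φ : Q' ⟶ Q)
    (f : P ⟶ (starRight A).obj (op Q)) :
    nakayamaHom K P Q' (f ≫ (starRight A).map φ.op) =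
      nakayamaHom K P Q f ≫ (dualLeft K A).map φ.op := rfl

variable [IsSemisimpleRing K]

lemma nakayamaHom_injective (P : ModuleCat.{u} A) (Q : ModuleCat.{u} Aᵐᵒᵖ) :
    Function.Injective (nakayamaHom K P Q) := by
  intro f g h
  exact congrArg starUnflip (dualLeft_map_injective h)

lemma nakayamaHom_surjective [Module.Finite K A] (P : ModuleCat.{u} A) (Q : ModuleCat.{u} Aᵐᵒᵖ)
    [Module.Finite A P] [Projective P] :
    Function.Surjective (nakayamaHom K P Q) := by
  intro g
  have := finite_star P
  obtain ⟨h, rfl⟩ := exists_dualLeft_map_eq (V := (star A).obj (op P)) g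
  exact ⟨starUnflip h, rfl⟩

lemma injective_nakayama (P : ModuleCat.{u} A) [Module.Finite A P] [Projective P] :
    Injective ((nakayama K A).obj P) := by
  have := projective_star P
  exact injective_dualLeft ((star A).obj (op P))

end Nakayama

/-! ### The functors `Hom(T, -)` and `D Hom(-, T)` -/

section HomFunctor

variable (A : Type u) [Ring A] (T : Type u) [AddCommGroup T] [Module A T]

/-- `Hom_A(T, X)` is a left module over `B = End(T)`, which acts on `T` from the right. -/
instance homModule (X : Type u) [AddCommGroup X] [Module A X] :
    Module (TiltedAlgebra A T) (T →ₗ[A] X) where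
  smul b f := f ∘ₗ b.unop
  one_smul _ := rfl
  mul_smul _ _ _ := rfl
  smul_zero _ := rfl
  smul_add _ _ _ := rfl
  add_smul b c f := LinearMap.comp_add b.unop c.unop f
  zero_smul f := LinearMap.comp_zero f

/-- The functor `Hom_A(T, -)` from `A`-modules to `B`-modules. -/
def homFunctor : ModuleCat.{u} A ⥤ ModuleCat.{u} (TiltedAlgebra A T) where
  obj X := ModuleCat.of (TiltedAlgebra A T) (T →ₗ[A] X)
  map φ := ModuleCat.ofHom
    { toFun := fun f => φ.hom ∘ₗ f
      map_add' := fun f g => LinearMap.comp_add f g φ.hom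
      map_smul' := fun _ _ => rfl }

instance : (homFunctor A T).Additive where
  map_add {_ _ _ _} := rfl

variable {A T}

/-- The morphism `B = Hom_A(T, T) → Hom_A(T, X)` induced by a morphism `T → X`. -/
def homRegular {X : ModuleCat.{u} A} (v : ModuleCat.of A T ⟶ X) :
    ModuleCat.of (TiltedAlgebra A T) (TiltedAlgebra A T) ⟶ (homFunctor A T).obj X :=
  ModuleCat.ofHom (Y := (homFunctor A T).obj X)
    { toFun := fun b => (show T →ₗ[A] X from v.hom ∘ₗ b.unop)
      map_add' := fun b c => LinearMap.comp_add b.unop c.unop v.hom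
      map_smul' := fun _ _ => rfl }

lemma homRegular_naturality {X : ModuleCat.{u} A} (v : ModuleCat.of A T ⟶ X) (γ : X ⟶ X)
    (b : TiltedAlgebra A T) (h : ModuleCat.ofHom b.unop ≫ v = v ≫ γ) :
    actHom (TiltedAlgebra A T) (TiltedAlgebra A T)ᵐᵒᵖ (TiltedAlgebra A T) (MulOpposite.op b) ≫
      homRegular v = homRegular v ≫ (homFunctor A T).map γ := by
  refine ModuleCat.hom_ext (LinearMap.ext fun x => LinearMap.ext fun t => ?_)
  exact congrArg (fun k : ModuleCat.of A T ⟶ X => k (x.unop t)) h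

/-- For a sequence `T → J₀ → J₁`, the sequence `B → Hom_A(T, J₀) → Hom_A(T, J₁)`. -/
abbrev homComplex {J₀ J₁ : ModuleCat.{u} A} (v : ModuleCat.of A T ⟶ J₀) (q : J₀ ⟶ J₁)
    (h : v ≫ q = 0) : ShortComplex (ModuleCat.{u} (TiltedAlgebra A T)) :=
  ShortComplex.mk (homRegular v) ((homFunctor A T).map q) (by
    refine ModuleCat.hom_ext (LinearMap.ext fun x => LinearMap.ext fun t => ?_)
    exact congrArg (fun k : ModuleCat.of A T ⟶ J₁ => k (x.unop t)) h)

/-- A morphism from `X` lifts along the epimorphism of a short exact sequence, if the extension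
group of `X` with the kernel vanishes. -/
lemma exists_lift_of_ext_vanishing {S : ShortComplex (ModuleCat.{u} A)} (hS : S.ShortExact)
    {X : ModuleCat.{u} A} (h : Subsingleton (Abelian.Ext.{u} X S.X₁ 1)) (f : X ⟶ S.X₃) :
    ∃ g : X ⟶ S.X₂, g ≫ S.g = f := by
  obtain ⟨y, hy⟩ := Abelian.Ext.covariant_sequence_exact₃ X hS (Abelian.Ext.mk₀ f) (zero_add 1)
    (Subsingleton.elim _ _)
  obtain ⟨g, rfl⟩ := mk₀_surjective y
  rw [Abelian.Ext.mk₀_comp_mk₀] at hy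
  exact ⟨g, (Abelian.Ext.mk₀_bijective _ _).1 hy⟩

/-- A morphism to `Y` extends along the monomorphism of a short exact sequence, if the extension
group of the cokernel with `Y` vanishes. -/
lemma exists_extension_of_ext_vanishing {S : ShortComplex (ModuleCat.{u} A)} (hS : S.ShortExact)
    {Y : ModuleCat.{u} A} (h : Subsingleton (Abelian.Ext.{u} S.X₃ Y 1)) (f : S.X₁ ⟶ Y) :
    ∃ g : S.X₂ ⟶ Y, S.f ≫ g = f := by
  obtain ⟨y, hy⟩ := Abelian.Ext.contravariant_sequence_exact₁ hS Y (Abelian.Ext.mk₀ f) (add_zero 1)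
    (Subsingleton.elim _ _)
  obtain ⟨g, rfl⟩ := mk₀_surjective y
  rw [Abelian.Ext.mk₀_comp_mk₀] at hy
  exact ⟨g, (Abelian.Ext.mk₀_bijective _ _).1 hy⟩

lemma shortExact_homComplex
    (hT : Subsingleton (Abelian.Ext.{u} (ModuleCat.of A T) (ModuleCat.of A T) 1))
    {J₀ J₁ : ModuleCat.{u} A} (v : ModuleCat.of A T ⟶ J₀) (q : J₀ ⟶ J₁)
    (h : v ≫ q = 0) (hS : (ShortComplex.mk v q h).ShortExact) :
    (homComplex v q h).ShortExact := by
  have hv : Mono v := hS.mono_f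
  refine shortExact_moduleCat _ ?_ ?_ ?_
  · intro b c hbc
    have h1 : ModuleCat.ofHom b.unop ≫ v = ModuleCat.ofHom c.unop ≫ v :=
      ModuleCat.hom_ext hbc
    have h2 := congrArg ModuleCat.Hom.hom ((cancel_mono v).1 h1)
    exact MulOpposite.unop_injective h2
  · intro x hx
    have h1 : ModuleCat.ofHom (show T →ₗ[A] J₀ from x) ≫ q = 0 := ModuleCat.hom_ext hx
    have h2 := hS.exact.lift_f (ModuleCat.ofHom (show T →ₗ[A] J₀ from x)) h1
    exact ⟨MulOpposite.op (hS.exact.lift (ModuleCat.ofHom (show T →ₗ[A] J₀ from x)) h1).hom,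
      congrArg ModuleCat.Hom.hom h2⟩
  · intro x
    obtain ⟨g, hg⟩ := exists_lift_of_ext_vanishing hS hT
      (ModuleCat.ofHom (show T →ₗ[A] J₁ from x))
    exact ⟨g.hom, congrArg ModuleCat.Hom.hom hg⟩

end HomFunctor

section DualHom

variable (K : Type u) [CommRing K] (A : Type u) [Ring A] [Algebra K A]
  (T : Type u) [AddCommGroup T] [Module A T] [Module K T] [IsScalarTower K A T]

variable {A T} in
/-- Composition with an endomorphism of `T`, as a `K`-linear endomorphism of `Hom_A(X, T)`. -/
def postcomp (X : Type u) [AddCommGroup X] [Module A X] (β : Module.End A T) :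
    (X →ₗ[A] T) →ₗ[K] (X →ₗ[A] T) where
  toFun f := β ∘ₗ f
  map_add' f g := LinearMap.comp_add f g β
  map_smul' c f := LinearMap.ext fun x => LinearMap.map_smul_of_tower β c (f x)

variable {A T} in
/-- Composition with a homomorphism `X → Y`, as a `K`-linear map `Hom_A(Y, T) → Hom_A(X, T)`. -/
def precomp {X Y : Type u} [AddCommGroup X] [Module A X] [AddCommGroup Y] [Module A Y]
    (φ : X →ₗ[A] Y) : (Y →ₗ[A] T) →ₗ[K] (X →ₗ[A] T) where
  toFun f := f ∘ₗ φ
  map_add' _ _ := rfl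
  map_smul' _ _ := rfl

/-- `D Hom_A(X, T)` is a left module over `B = End(T)`, which acts on `T` from the right. -/
instance dualHomModule (X : Type u) [AddCommGroup X] [Module A X] :
    Module (TiltedAlgebra A T) ((X →ₗ[A] T) →ₗ[K] K) where
  smul b ξ := ξ ∘ₗ postcomp K X b.unop
  one_smul _ := rfl
  mul_smul _ _ _ := rfl
  smul_zero _ := rfl
  smul_add _ _ _ := rfl
  add_smul b c ξ := LinearMap.ext fun f => map_add ξ (b.unop ∘ₗ f) (c.unop ∘ₗ f)
  zero_smul ξ := LinearMap.ext fun _ => map_zero ξ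

/-- The functor `D Hom_A(-, T)` from `A`-modules to `B`-modules. -/
def dualHom : ModuleCat.{u} A ⥤ ModuleCat.{u} (TiltedAlgebra A T) where
  obj X := ModuleCat.of (TiltedAlgebra A T) ((X →ₗ[A] T) →ₗ[K] K)
  map φ := ModuleCat.ofHom
    { toFun := fun ξ => ξ ∘ₗ precomp K φ.hom
      map_add' := fun _ _ => rfl
      map_smul' := fun _ _ => rfl }

variable {K A T}

/-- The linear form on `Hom_A(X, T)` given by an element of `D Hom_A(X, T)`. -/
abbrev toHomForm {X : ModuleCat.{u} A} (ξ : (dualHom K A T).obj X) : (X →ₗ[A] T) →ₗ[K] K := ξ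

/-- The canonical map `D Hom_A(X, T) → Hom_A(T, ν X)`, which sends a form `ξ` to
`t ↦ (f ↦ ξ (x ↦ f(x) t))`. -/
def dualHomToHom (X : ModuleCat.{u} A) :
    (dualHom K A T).obj X ⟶ (homFunctor A T).obj ((nakayama K A).obj X) :=
  ModuleCat.ofHom (Y := (homFunctor A T).obj ((nakayama K A).obj X))
    { toFun := fun ξ =>
        (show T →ₗ[A] (nakayama K A).obj X from
        { toFun := fun t => ofForm (Q := (star A).obj (op X)) (mkDual K
            { toFun := fun f => toHomForm ξ
                (LinearMap.toSpanSingleton A T t ∘ₗ (show X →ₗ[A] A from f))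
              map_zero' := by
                rw [← map_zero (toHomForm ξ)]
                exact congrArg _ (LinearMap.ext fun x => zero_smul A t)
              map_add' := fun f g => by
                rw [← map_add (toHomForm ξ)]
                exact congrArg _ (LinearMap.ext fun x => add_smul _ _ t) }
            (fun c f => by
              refine Eq.trans (congrArg (toHomForm ξ) (LinearMap.ext fun x => ?_))
                (map_smul (toHomForm ξ) c _)
              change ((show X →ₗ[A] A from f) x * algebraMap K A c) • t =
                c • ((show X →ₗ[A] A from f) x • t)
              rw [← Algebra.commutes, mul_smul, algebraMap_smul]))
          map_add' := fun t s => dualLeft_ext fun f => by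
            refine Eq.trans ?_ (map_add (toHomForm ξ) _ _)
            exact congrArg (toHomForm ξ) (LinearMap.ext fun x => smul_add _ t s)
          map_smul' := fun a t => dualLeft_ext fun f => by
            refine congrArg (toHomForm ξ) (LinearMap.ext fun x => ?_)
            exact (mul_smul ((show X →ₗ[A] A from f) x) a t).symm })
      map_add' := fun _ _ => rfl
      map_smul' := fun b ξ => LinearMap.ext fun t => dualLeft_ext fun f => by
        refine congrArg (toHomForm ξ) (LinearMap.ext fun x => ?_)
        exact map_smul b.unop ((show X →ₗ[A] A from f) x) t }

lemma dualHomToHom_apply (X : ModuleCat.{u} A) (ξ : (dualHom K A T).obj X) (t : T)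
    (f : X →ₗ[A] A) :
    toForm (Q := (star A).obj (op X))
      ((show T →ₗ[A] (nakayama K A).obj X from dualHomToHom X ξ) t) f =
      toHomForm ξ (LinearMap.toSpanSingleton A T t ∘ₗ f) := rfl

lemma dualHomToHom_naturality {X Y : ModuleCat.{u} A} (φ : X ⟶ Y) :
    (dualHom K A T).map φ ≫ dualHomToHom Y =
      dualHomToHom X ≫ (homFunctor A T).map ((nakayama K A).map φ) := rfl

/-- For a finitely generated projective module `P`, the map `D Hom_A(P, T) → Hom_A(T, ν P)` is an
isomorphism. A dual basis of `P` gives the inverse. -/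
lemma isIso_dualHomToHom (P : ModuleCat.{u} A) [Module.Finite A P] [Projective P] :
    IsIso (dualHomToHom (K := K) (T := T) P) := by
  obtain ⟨n, ⟨r⟩⟩ := exists_retract_free P
  let e (j : Fin n) : P := r.r.hom fun i => if j = i then (1 : A) else 0
  let e' (j : Fin n) : P →ₗ[A] A := LinearMap.proj j ∘ₗ r.i.hom
  have hsum (x : P) : ∑ j, e' j x • e j = x := by
    have h1 : r.r.hom (r.i.hom x) = x :=
      congrArg (fun k : P ⟶ P => k x) r.retract
    conv_rhs => rw [← h1]
    exact (LinearMap.pi_apply_eq_sum_univ r.r.hom (r.i.hom x)).symm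
  rw [ConcreteCategory.isIso_iff_bijective]
  constructor
  · intro ξ η h
    refine LinearMap.ext fun φ => ?_
    have hφ : φ = ∑ j, LinearMap.toSpanSingleton A T (φ (e j)) ∘ₗ e' j := by
      refine LinearMap.ext fun x => ?_
      conv_lhs => rw [← hsum x]
      simp [map_sum, LinearMap.sum_apply]
    rw [hφ]
    change toHomForm ξ _ = toHomForm η _
    rw [map_sum, map_sum]
    refine Finset.sum_congr rfl fun j _ => ?_
    rw [← dualHomToHom_apply, ← dualHomToHom_apply, h]
  · intro g
    let g' : T →ₗ[A] (nakayama K A).obj P := g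
    let η (t : T) : (P →ₗ[A] A) →+ K :=
      { toFun := fun f => toForm (Q := (star A).obj (op P)) (g' t) f
        map_zero' := map_zero (toForm (Q := (star A).obj (op P)) (g' t))
        map_add' := fun f f' => map_add (toForm (Q := (star A).obj (op P)) (g' t)) f f' }
    let ξ : (P →ₗ[A] T) →ₗ[K] K :=
      { toFun := fun φ => ∑ j, η (φ (e j)) (e' j)
        map_add' := fun φ ψ => by
          rw [← Finset.sum_add_distrib]
          refine Finset.sum_congr rfl fun j _ => ?_
          have : g' ((φ + ψ) (e j)) = _ := map_add g' (φ (e j)) (ψ (e j))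
          exact LinearMap.congr_fun (f := toForm (g' ((φ + ψ) (e j)))) this (e' j)
        map_smul' := fun c φ => by
          rw [RingHom.id_apply, Finset.smul_sum]
          refine Finset.sum_congr rfl fun j _ => ?_
          have h1 : (c • φ) (e j) = algebraMap K A c • φ (e j) :=
            (algebraMap_smul A c (φ (e j))).symm
          have : g' ((c • φ) (e j)) = algebraMap K A c • g' (φ (e j)) := by
            rw [h1, map_smul]
          refine (LinearMap.congr_fun (f := toForm (g' ((c • φ) (e j)))) this (e' j)).trans ?_
          exact dualCarrier_algebraMap_smul K (toForm (g' (φ (e j)))) c _ }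
    refine ⟨ξ, LinearMap.ext fun t => dualLeft_ext fun f => ?_⟩
    let f' : P →ₗ[A] A := f
    change ∑ j, η (f' (e j) • t) (e' j) = η t f'
    have h1 (j : Fin n) : η (f' (e j) • t) (e' j) = η t (MulOpposite.op (f' (e j)) • e' j) := by
      have : g' (f' (e j) • t) = _ := map_smul g' (f' (e j)) t
      exact LinearMap.congr_fun (f := toForm (g' (f' (e j) • t))) this (e' j)
    rw [Finset.sum_congr rfl fun j _ => h1 j, ← map_sum (η t)]
    refine congrArg (η t) (LinearMap.ext fun x => ?_)
    conv_rhs => rw [← hsum x]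
    simp [map_sum, LinearMap.sum_apply]

/-- The morphism `D Hom_A(X, T) → D Hom_A(T, T) = D B` induced by a morphism `X → T`. -/
def dualHomToDualRegular {X : ModuleCat.{u} A} (p : X ⟶ ModuleCat.of A T) :
    (dualHom K A T).obj X ⟶ dualRegular K (TiltedAlgebra A T) :=
  ModuleCat.ofHom (Y := dualRegular K (TiltedAlgebra A T))
    { toFun := fun ξ => ofForm (A := TiltedAlgebra A T)
        (Q := ModuleCat.of (TiltedAlgebra A T)ᵐᵒᵖ (TiltedAlgebra A T)) (mkDual K
        { toFun := fun b => toHomForm ξ ((MulOpposite.unop b : Module.End A T) ∘ₗ p.hom)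
          map_zero' := map_zero (toHomForm ξ)
          map_add' := fun b c => map_add (toHomForm ξ)
            ((MulOpposite.unop b : Module.End A T) ∘ₗ p.hom)
            ((MulOpposite.unop c : Module.End A T) ∘ₗ p.hom) }
        (fun c b => map_smul (toHomForm ξ) c ((MulOpposite.unop b : Module.End A T) ∘ₗ p.hom)))
      map_add' := fun _ _ => rfl
      map_smul' := fun _ _ => rfl }

lemma dualHomToDualRegular_naturality {X : ModuleCat.{u} A} (p : X ⟶ ModuleCat.of A T)
    (φ : X ⟶ X) (b : TiltedAlgebra A T) (h : φ ≫ p = p ≫ ModuleCat.ofHom b.unop) :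
    (dualHom K A T).map φ ≫ dualHomToDualRegular p =
      dualHomToDualRegular p ≫ (dualRegularAct K (TiltedAlgebra A T) b).unop := by
  ext ξ
  refine dualLeft_ext (A := TiltedAlgebra A T) fun c => congrArg (toHomForm ξ) ?_
  exact congrArg (fun k : X ⟶ ModuleCat.of A T => (MulOpposite.unop c : Module.End A T) ∘ₗ k.hom) h

/-- For a sequence `P₁ → P₀ → T`, the sequence
`D Hom_A(P₁, T) → D Hom_A(P₀, T) → D Hom_A(T, T) = D B`. -/
abbrev dualHomComplex {P₁ P₀ : ModuleCat.{u} A} (i : P₁ ⟶ P₀) (p : P₀ ⟶ ModuleCat.of A T)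
    (h : i ≫ p = 0) : ShortComplex (ModuleCat.{u} (TiltedAlgebra A T)) :=
  ShortComplex.mk ((dualHom K A T).map i) (dualHomToDualRegular p) (by
    ext ξ
    refine dualLeft_ext (A := TiltedAlgebra A T) fun c => ?_
    refine Eq.trans (congrArg (toHomForm ξ) ?_) (map_zero (toHomForm ξ))
    refine LinearMap.ext fun x => ?_
    exact (congrArg (fun k : P₁ ⟶ ModuleCat.of A T =>
      (MulOpposite.unop c : Module.End A T) (k x)) h).trans (map_zero _))

lemma shortExact_dualHomComplex [IsSemisimpleRing K]
    (hT : Subsingleton (Abelian.Ext.{u} (ModuleCat.of A T) (ModuleCat.of A T) 1))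
    {P₁ P₀ : ModuleCat.{u} A} (i : P₁ ⟶ P₀) (p : P₀ ⟶ ModuleCat.of A T)
    (h : i ≫ p = 0) (hS : (ShortComplex.mk i p h).ShortExact) :
    (dualHomComplex (K := K) i p h).ShortExact := by
  have hp : Epi p := hS.epi_g
  have hi (f : P₁ →ₗ[A] T) : ∃ g : P₀ →ₗ[A] T, g ∘ₗ i.hom = f := by
    obtain ⟨g, hg⟩ := exists_extension_of_ext_vanishing hS hT (ModuleCat.ofHom f)
    exact ⟨g.hom, congrArg ModuleCat.Hom.hom hg⟩
  refine shortExact_moduleCat _ ?_ ?_ ?_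
  · intro ξ η e
    refine LinearMap.ext fun f => ?_
    obtain ⟨g, rfl⟩ := hi f
    exact LinearMap.congr_fun (f := toHomForm ((dualHom K A T).map i ξ)) e g
  · intro ξ hξ
    obtain ⟨g, hg⟩ := exists_linearForm_comp_eq (precomp K (T := T) i.hom) (toHomForm ξ) (by
      intro f hf
      have h1 : i ≫ ModuleCat.ofHom f = 0 := ModuleCat.hom_ext hf
      have h2 := hS.exact.g_desc (ModuleCat.ofHom f) h1
      have h3 : f = (hS.exact.desc (ModuleCat.ofHom f) h1).hom ∘ₗ p.hom :=
        (congrArg ModuleCat.Hom.hom h2).symm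
      rw [h3]
      exact LinearMap.congr_fun (f := toForm (A := TiltedAlgebra A T)
        (Q := ModuleCat.of (TiltedAlgebra A T)ᵐᵒᵖ (TiltedAlgebra A T))
        (dualHomToDualRegular p ξ)) (g := 0) hξ
        (MulOpposite.op (hS.exact.desc (ModuleCat.ofHom f) h1).hom))
    exact ⟨g, LinearMap.ext hg⟩
  · intro l
    let l' : (T →ₗ[A] T) →ₗ[K] K :=
      { toFun := fun f => toForm (A := TiltedAlgebra A T)
          (Q := ModuleCat.of (TiltedAlgebra A T)ᵐᵒᵖ (TiltedAlgebra A T)) l (MulOpposite.op f)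
        map_add' := fun f g => dualCarrier_add K (R := (TiltedAlgebra A T)ᵐᵒᵖ)
          (M := ModuleCat.of (TiltedAlgebra A T)ᵐᵒᵖ (TiltedAlgebra A T)) l
          (MulOpposite.op f) (MulOpposite.op g)
        map_smul' := fun c f => dualCarrier_algebraMap_smul K (R := (TiltedAlgebra A T)ᵐᵒᵖ)
          (M := ModuleCat.of (TiltedAlgebra A T)ᵐᵒᵖ (TiltedAlgebra A T)) l c
          (MulOpposite.op f) }
    obtain ⟨g, hg⟩ := exists_linearForm_comp_eq (precomp K (T := T) p.hom) l' (by
      intro f hf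
      have h1 : p ≫ ModuleCat.ofHom f = p ≫ 0 := by
        rw [Limits.comp_zero]; exact ModuleCat.hom_ext hf
      have h2 : f = 0 := congrArg ModuleCat.Hom.hom ((cancel_epi p).1 h1)
      rw [h2, map_zero])
    exact ⟨g, dualLeft_ext (A := TiltedAlgebra A T) fun c => hg (MulOpposite.unop c)⟩

end DualHom

/-! ### Hereditary algebras and resolutions by summands of sums of `T` -/

section AddClosure

variable {C : Type u₁} [Category.{v₁} C] [Preadditive C]

/-- `M` is a direct summand of a finite direct sum of copies of `X`: the identity of `M` is a finite
sum of endomorphisms which factor through `X`. -/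
def IsSummandOfSum (X M : C) : Prop :=
  ∃ (n : ℕ) (a : Fin n → (M ⟶ X)) (b : Fin n → (X ⟶ M)), ∑ j, a j ≫ b j = 𝟙 M

lemma IsSummandOfSum.refl (X : C) :
    IsSummandOfSum X X :=
  ⟨1, fun _ => 𝟙 X, fun _ => 𝟙 X, by simp⟩

lemma IsSummandOfSum.of_retract {X M N : C} (h : IsSummandOfSum X M) (r : Retract N M) :
    IsSummandOfSum X N := by
  obtain ⟨n, a, b, e⟩ := h
  refine ⟨n, fun j => r.i ≫ a j, fun j => b j ≫ r.r, ?_⟩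
  have : ∑ j, (r.i ≫ a j) ≫ (b j ≫ r.r) = r.i ≫ (∑ j, a j ≫ b j) ≫ r.r := by
    simp [Preadditive.sum_comp, Preadditive.comp_sum]
  rw [this, e, Category.id_comp, r.retract]

lemma IsSummandOfSum.map {D : Type u₂} [Category.{v₂} D] [Preadditive D] (F : C ⥤ D) [F.Additive]
    {X M : C} (h : IsSummandOfSum X M) : IsSummandOfSum (F.obj X) (F.obj M) := by
  obtain ⟨n, a, b, e⟩ := h
  refine ⟨n, fun j => F.map (a j), fun j => F.map (b j), ?_⟩
  rw [← F.map_id, ← e, F.map_sum]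
  simp

lemma IsSummandOfSum.projective {X M : C} (h : IsSummandOfSum X M) [Projective X] :
    Projective M where
  factors {E Y} f e _ := by
    obtain ⟨n, a, b, h⟩ := h
    refine ⟨∑ j, a j ≫ Projective.factorThru (b j ≫ f) e, ?_⟩
    rw [Preadditive.sum_comp]
    simp only [Category.assoc, Projective.factorThru_comp]
    simp only [← Category.assoc]
    rw [← Preadditive.sum_comp, h, Category.id_comp]

end AddClosure

section AddClosureExt

open Abelian

variable {C : Type u₁} [Category.{v₁} C] [Abelian C] [HasExt.{u} C]

lemma IsSummandOfSum.subsingleton_ext_left {X M Y : C} {n : ℕ} (h : IsSummandOfSum X M)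
    (hX : Subsingleton (Ext.{u} X Y n)) : Subsingleton (Ext.{u} M Y n) := by
  refine subsingleton_of_forall_eq 0 fun x => ?_
  obtain ⟨m, a, b, h⟩ := h
  let Φ : (M ⟶ M) →+ Ext.{u} M Y n :=
    { toFun := fun f => (Ext.mk₀ f).comp x (zero_add n)
      map_zero' := by rw [Ext.mk₀_zero, Ext.zero_comp]
      map_add' := fun f g => by rw [Ext.mk₀_add, Ext.add_comp] }
  have h0 (j : Fin m) : Φ (a j ≫ b j) = 0 := by
    change (Ext.mk₀ (a j ≫ b j)).comp x (zero_add n) = 0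
    have hb : (Ext.mk₀ (b j)).comp x (zero_add n) = 0 := Subsingleton.elim _ _
    rw [← Ext.mk₀_comp_mk₀_assoc, hb, Ext.comp_zero]
  have h1 : Φ (𝟙 M) = x := Ext.mk₀_id_comp x
  rw [← h1, ← h, map_sum]
  exact Finset.sum_eq_zero fun j _ => h0 j

lemma IsSummandOfSum.subsingleton_ext_right {X M Y : C} {n : ℕ} (h : IsSummandOfSum X M)
    (hX : Subsingleton (Ext.{u} Y X n)) : Subsingleton (Ext.{u} Y M n) := by
  refine subsingleton_of_forall_eq 0 fun x => ?_
  obtain ⟨m, a, b, h⟩ := h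
  let Φ : (M ⟶ M) →+ Ext.{u} Y M n :=
    { toFun := fun f => x.comp (Ext.mk₀ f) (add_zero n)
      map_zero' := by rw [Ext.mk₀_zero, Ext.comp_zero]
      map_add' := fun f g => by rw [Ext.mk₀_add, Ext.comp_add] }
  have h0 (j : Fin m) : Φ (a j ≫ b j) = 0 := by
    change x.comp (Ext.mk₀ (a j ≫ b j)) (add_zero n) = 0
    have ha : x.comp (Ext.mk₀ (a j)) (add_zero n) = 0 := Subsingleton.elim _ _
    rw [← Ext.mk₀_comp_mk₀, ← Ext.comp_assoc _ _ _ (add_zero n) (add_zero 0) (by lia), ha,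
      Ext.zero_comp]
  have h1 : Φ (𝟙 M) = x := Ext.comp_mk₀_id x
  rw [← h1, ← h, map_sum]
  exact Finset.sum_eq_zero fun j _ => h0 j

end AddClosureExt

section Hereditary

variable {A : Type u} [Ring A]

/-- Over a hereditary ring, a quotient of an injective module is injective: by Baer's criterion, it
is enough to extend maps from left ideals, and these are projective. -/
lemma IsHereditary.injective_of_epi (hA : IsHereditary A) {I J : ModuleCat.{u} A} (q : I ⟶ J)
    [Epi q] [hI : Injective I] : Injective J := by
  have hI' : Module.Injective A I := Module.injective_module_of_injective_object A I
  have hq : Function.Surjective q.hom := (ModuleCat.epi_iff_surjective q).1 inferInstance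
  suffices Module.Injective A J from Module.injective_object_of_injective_module A J
  refine Module.Baer.injective fun a g => ?_
  have := hA a
  obtain ⟨l, hl⟩ := Module.projective_lifting_property q.hom g hq
  obtain ⟨k, hk⟩ := Module.Baer.of_injective hI' a l
  refine ⟨q.hom ∘ₗ k, fun x hx => ?_⟩
  rw [← hl]
  exact congrArg q.hom (hk x hx)

/-- The center of a hereditary ring is reduced: for a central element `z`, the left ideal
`A z` is projective, so that `a ↦ a z` has a section `s`. If `z² = 0`, then `z` annihilates `s z`, and
`z = (s z) z = z (s z) = 0`. -/
lemma IsHereditary.isReduced_center (hA : IsHereditary A) : IsReduced (Subring.center A) := by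
  rw [isReduced_iff_pow_one_lt 2 one_lt_two]
  rintro ⟨z, hz⟩ h0
  have hz2 : z * z = 0 := by
    have := congrArg Subtype.val h0
    simpa [pow_two] using this
  have hc (g : A) : g * z = z * g := Subring.mem_center_iff.1 hz g
  let m : A →ₗ[A] A := LinearMap.toSpanSingleton A A z
  have : Module.Projective A (LinearMap.range m) := hA (LinearMap.range m)
  obtain ⟨s, hs⟩ := Module.projective_lifting_property m.rangeRestrict LinearMap.id
    m.surjective_rangeRestrict
  have hs' (y : LinearMap.range m) : s y * z = y :=
    congrArg Subtype.val (LinearMap.congr_fun hs y)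
  let y : LinearMap.range m := ⟨z, 1, one_mul z⟩
  -- `s y` is a preimage of `z` under `a ↦ a z`, and `z • y = 0` because `z² = 0`.
  have h1 : z * s y = 0 := by
    have : z • y = 0 := Subtype.ext hz2
    rw [← smul_eq_mul, ← map_smul, this, map_zero]
  have h2 : s y * z = z := hs' y
  rw [hc, h1] at h2
  exact Subtype.ext h2.symm

end Hereditary

section Artin

/-- The center of a hereditary artin algebra is semisimple. -/
lemma isSemisimpleRing_center {k : Type v} [CommRing k] [IsArtinianRing k] {A : Type u} [Ring A]
    [Algebra k A] [Module.Finite k A] (hA : IsHereditary A) :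
    IsSemisimpleRing (Subring.center A) := by
  have : IsReduced (Subring.center A) := hA.isReduced_center
  have h1 : IsArtinian k (Subalgebra.center k A) :=
    inferInstanceAs (IsArtinian k (Subalgebra.toSubmodule (Subalgebra.center k A)))
  have h2 : IsArtinianRing (Subalgebra.center k A) :=
    isArtinian_of_tower k h1
  let e : Subalgebra.center k A ≃+* Subring.center A :=
    { toFun := fun x => ⟨x.1, x.2⟩
      invFun := fun x => ⟨x.1, x.2⟩
      map_add' := fun _ _ => rfl
      map_mul' := fun _ _ => rfl }
  have h3 : IsArtinianRing (Subring.center A) := e.isArtinianRing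
  exact IsArtinianRing.isSemisimpleRing_of_isReduced _

/-- An artin algebra is a finitely generated module over its center. -/
lemma finite_center {k : Type v} [CommRing k] {A : Type u} [Ring A]
    [Algebra k A] [Module.Finite k A] : Module.Finite (Subring.center A) A := by
  obtain ⟨s, hs⟩ := (inferInstance : Module.Finite k A).fg_top
  refine ⟨⟨s, ?_⟩⟩
  rw [eq_top_iff]
  intro x _
  have hx : x ∈ Submodule.span k (s : Set A) := hs ▸ Submodule.mem_top
  induction hx using Submodule.span_induction with
  | mem x h => exact Submodule.subset_span h
  | zero => exact zero_mem _
  | add x y _ _ hx hy => exact add_mem (hx trivial) (hy trivial)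
  | smul c x _ hx =>
    let c' : Subring.center A := ⟨algebraMap k A c, Subring.mem_center_iff.2 fun g =>
      (Algebra.commutes c g).symm⟩
    have : c • x = c' • x := Algebra.smul_def c x
    rw [this]
    exact Submodule.smul_mem _ _ (hx trivial)

end Artin

section Approximation

variable {A : Type u} [Ring A] {T : Type u} [AddCommGroup T] [Module A T]

lemma isSummandOfSum_pi (n : ℕ) :
    IsSummandOfSum (ModuleCat.of A T) (ModuleCat.of A (Fin n → T)) := by
  refine ⟨n, fun j => ModuleCat.ofHom (LinearMap.proj j),
    fun j => ModuleCat.ofHom (LinearMap.single A (fun _ => T) j), ?_⟩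
  refine ModuleCat.hom_ext (LinearMap.ext fun x => ?_)
  rw [ModuleCat.hom_sum, LinearMap.sum_apply]
  exact Finset.univ_sum_single (f := x)

lemma InAdd.isSummandOfSum {M : ModuleCat.{u} A} (h : InAdd A T M) :
    IsSummandOfSum (ModuleCat.of A T) M := by
  obtain ⟨n, i, p, e⟩ := h
  exact (isSummandOfSum_pi n).of_retract
    ⟨ModuleCat.ofHom i, ModuleCat.ofHom p, ModuleCat.hom_ext e⟩

/-- For finitely generated modules over an algebra which is finite over a Noetherian central
subring, `Hom_A(T, X)` is finitely generated over `End(T)`. -/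
lemma exists_generators_hom (K : Type u) [CommRing K] [IsNoetherianRing K] [Algebra K A]
    [Module.Finite K A] [Module K T] [IsScalarTower K A T] [Module.Finite A T]
    (X : ModuleCat.{u} A) [Module.Finite A X] :
    ∃ (n : ℕ) (f : Fin n → (ModuleCat.of A T ⟶ X)), ∀ u : ModuleCat.of A T ⟶ X,
      ∃ v : Fin n → (ModuleCat.of A T ⟶ ModuleCat.of A T), u = ∑ j, v j ≫ f j := by
  let _ : Module K X := Module.compHom X (algebraMap K A)
  have : IsScalarTower K A X := IsScalarTower.of_algebraMap_smul fun _ _ => rfl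
  have : Module.Finite K X := Module.Finite.trans (R := K) A X
  obtain ⟨m, t, ht⟩ := Module.Finite.exists_fin (R := A) (M := T)
  let ev : (T →ₗ[A] X) →ₗ[K] (Fin m → X) :=
    { toFun := fun f j => f (t j)
      map_add' := fun _ _ => rfl
      map_smul' := fun _ _ => rfl }
  have hev : Function.Injective ev := fun f g h =>
    LinearMap.ext_on_range (v := t) ht fun j => congrFun h j
  have : IsNoetherian K (T →ₗ[A] X) := isNoetherian_of_injective ev hev
  obtain ⟨n, f, hf⟩ := Module.Finite.exists_fin (R := K) (M := T →ₗ[A] X)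
  refine ⟨n, fun j => ModuleCat.ofHom (f j), fun u => ?_⟩
  have hu : u.hom ∈ Submodule.span K (Set.range f) := hf ▸ Submodule.mem_top
  obtain ⟨c, hc⟩ := (Submodule.mem_span_range_iff_exists_fun K).1 hu
  refine ⟨fun j => ModuleCat.ofHom (c j • LinearMap.id), ?_⟩
  refine ModuleCat.hom_ext ?_
  rw [← hc, ModuleCat.hom_sum]
  refine Finset.sum_congr rfl fun j _ => LinearMap.ext fun x => ?_
  exact (LinearMap.map_smul_of_tower (f j) (c j) x).symm

/-- If `Ext¹(T, X) = 0`, then every element of `X` is in the sum of the images of finitely many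
maps `T → X`: the map `A → X` given by the element extends along `A → T₀`. -/
lemma IsTilting.exists_sum_eq (hT : IsTilting A T) (X : ModuleCat.{u} A)
    (hX : Subsingleton (Abelian.Ext.{u} (ModuleCat.of A T) X 1)) (x : X) :
    ∃ (n : ℕ) (g : Fin n → (ModuleCat.of A T ⟶ X)) (t : Fin n → T), x = ∑ j, (g j).hom (t j) := by
  obtain ⟨T₀, T₁, f, g, h₀, h₁, hf, hfg, hg⟩ := hT.coresolution
  let S : ShortComplex (ModuleCat.{u} A) :=
    ShortComplex.mk (ModuleCat.ofHom f) (ModuleCat.ofHom g)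
      (ModuleCat.hom_ext (LinearMap.ext fun y => hfg.apply_apply_eq_zero y))
  have hS : S.ShortExact := shortExact_moduleCat S hf (fun y hy => (hfg y).1 hy) hg
  obtain ⟨l, hl⟩ := exists_extension_of_ext_vanishing hS
    (h₁.isSummandOfSum.subsingleton_ext_left hX)
    (ModuleCat.ofHom (LinearMap.toSpanSingleton A X x))
  obtain ⟨n, a, b, e⟩ := h₀.isSummandOfSum
  refine ⟨n, fun j => b j ≫ l, fun j => (a j).hom (f 1), ?_⟩
  have h1 : l.hom (f 1) = x := by
    have h2 : l.hom (f 1) = (1 : A) • x :=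
      congrArg (fun k : ModuleCat.of A A ⟶ X => k.hom (1 : A)) hl
    rw [h2, one_smul]
  have h2 : ∑ j, (b j).hom ((a j).hom (f 1)) = f 1 := by
    have h3 := congrArg (fun k : T₀ ⟶ T₀ => k.hom (f 1)) e
    rw [ModuleCat.hom_sum, LinearMap.sum_apply] at h3
    exact h3
  rw [← h1]
  conv_lhs => rw [← h2]
  rw [map_sum]
  rfl

/-- A module `X` with `Ext¹(T, X) = 0` has a universal map from a direct sum of copies of `T`. It is
surjective, and its kernel `X'` satisfies `Ext¹(T, X') = 0`. -/
lemma IsTilting.exists_approximation (hT : IsTilting A T) (K : Type u) [CommRing K]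
    [IsNoetherianRing K] [Algebra K A] [Module.Finite K A] [Module K T] [IsScalarTower K A T]
    (X : ModuleCat.{u} A) [Module.Finite A X]
    (hX : Subsingleton (Abelian.Ext.{u} (ModuleCat.of A T) X 1)) :
    ∃ (X' X₀ : ModuleCat.{u} A) (i : X' ⟶ X₀) (p : X₀ ⟶ X) (h : i ≫ p = 0),
      (ShortComplex.mk i p h).ShortExact ∧ Module.Finite A X' ∧
      IsSummandOfSum (ModuleCat.of A T) X₀ ∧
      Subsingleton (Abelian.Ext.{u} (ModuleCat.of A T) X' 1) ∧
      ∀ u : ModuleCat.of A T ⟶ X, ∃ v : ModuleCat.of A T ⟶ X₀, v ≫ p = u := by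
  have := hT.finite
  have : IsNoetherianRing A := isNoetherian_of_tower K inferInstance
  obtain ⟨n, f, hf⟩ := exists_generators_hom (T := T) K X
  let φ : (Fin n → T) →ₗ[A] X := LinearMap.lsum A (fun _ => T) ℕ fun j => (f j).hom
  have hφ (y : Fin n → T) : φ y = ∑ j, (f j).hom (y j) := by
    simp [φ, LinearMap.lsum_apply]
  have hlift (u : ModuleCat.of A T ⟶ X) :
      ∃ v : ModuleCat.of A T ⟶ ModuleCat.of A (Fin n → T), v ≫ ModuleCat.ofHom φ = u := by
    obtain ⟨v, rfl⟩ := hf u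
    refine ⟨ModuleCat.ofHom (LinearMap.pi fun j => (v j).hom), ModuleCat.hom_ext ?_⟩
    refine LinearMap.ext fun t => ?_
    rw [ModuleCat.hom_sum, LinearMap.sum_apply]
    exact hφ _
  have hsurj : Function.Surjective φ := by
    intro x
    obtain ⟨m, g, t, rfl⟩ := hT.exists_sum_eq X hX x
    choose v hv using fun j => hlift (g j)
    refine ⟨∑ j, (v j).hom (t j), ?_⟩
    rw [map_sum]
    refine Finset.sum_congr rfl fun j _ => ?_
    exact congrArg (fun k : ModuleCat.of A T ⟶ X => k.hom (t j)) (hv j)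
  have h0 : ModuleCat.ofHom (LinearMap.ker φ).subtype ≫ ModuleCat.ofHom φ = 0 :=
    ModuleCat.hom_ext (LinearMap.ext fun x => x.2)
  have hS : (ShortComplex.mk (ModuleCat.ofHom (LinearMap.ker φ).subtype) (ModuleCat.ofHom φ)
      h0).ShortExact :=
    shortExact_moduleCat _ Subtype.val_injective (fun x hx => ⟨⟨x, hx⟩, rfl⟩) hsurj
  have hfin : Module.Finite A (LinearMap.ker φ) := inferInstance
  refine ⟨_, _, _, _, h0, hS, hfin, isSummandOfSum_pi n, ?_, hlift⟩
  refine subsingleton_of_forall_eq 0 fun x => ?_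
  have hsub := (isSummandOfSum_pi (A := A) (T := T) n).subsingleton_ext_right hT.ext_one_self
  obtain ⟨y, rfl⟩ := Abelian.Ext.covariant_sequence_exact₁ _ hS x (Subsingleton.elim _ _)
    (zero_add 1)
  obtain ⟨u, rfl⟩ := mk₀_surjective y
  obtain ⟨v, rfl⟩ := hlift u
  rw [← Abelian.Ext.mk₀_comp_mk₀_assoc, hS.comp_extClass, Abelian.Ext.comp_zero]

/-- Over a hereditary algebra, the kernel of the universal map is a direct summand of a direct sum
of copies of `T`: the universal map to the kernel splits. -/
lemma IsTilting.exists_resolution (hT : IsTilting A T) (hA : IsHereditary A) (K : Type u)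
    [CommRing K] [IsNoetherianRing K] [Algebra K A] [Module.Finite K A] [Module K T]
    [IsScalarTower K A T] (X : ModuleCat.{u} A) [Module.Finite A X]
    (hX : Subsingleton (Abelian.Ext.{u} (ModuleCat.of A T) X 1)) :
    ∃ (X' X₀ : ModuleCat.{u} A) (i : X' ⟶ X₀) (p : X₀ ⟶ X) (h : i ≫ p = 0),
      (ShortComplex.mk i p h).ShortExact ∧ IsSummandOfSum (ModuleCat.of A T) X' ∧
      IsSummandOfSum (ModuleCat.of A T) X₀ ∧
      ∀ u : ModuleCat.of A T ⟶ X, ∃ v : ModuleCat.of A T ⟶ X₀, v ≫ p = u := by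
  obtain ⟨X', X₀, i, p, h, hS, hfin, hX₀, hX', hlift⟩ := hT.exists_approximation K X hX
  refine ⟨X', X₀, i, p, h, hS, ?_, hX₀, hlift⟩
  obtain ⟨X'', Y₀, i', p', h', hS', -, hY₀, hX'', -⟩ := hT.exists_approximation K X' hX'
  suffices hvan : Subsingleton (Abelian.Ext.{u} X' X'' 1) by
    obtain ⟨s, hs⟩ := exists_lift_of_ext_vanishing hS' hvan (𝟙 X')
    exact hY₀.of_retract ⟨s, p', hs⟩
  -- A class in `Ext¹(X', X'')` is given by a map to the cokernel of an embedding of `X''` into an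
  -- injective module. As this cokernel is injective, the class is the restriction of a
  -- class in `Ext¹(X₀, X'') = 0`.
  let c := Injective.ι X''
  let q := Limits.cokernel.π c
  have hc : (ShortComplex.mk c q (Limits.cokernel.condition c)).ShortExact :=
    ShortComplex.ShortExact.mk' (ShortComplex.exact_cokernel c) inferInstance inferInstance
  have hinj : Injective (Limits.cokernel c) := hA.injective_of_epi q
  have hi : Mono i := hS.mono_f
  refine subsingleton_of_forall_eq 0 fun x => ?_
  obtain ⟨y, rfl⟩ := Abelian.Ext.covariant_sequence_exact₁ _ hc x
    (Abelian.Ext.eq_zero_of_injective _) (zero_add 1)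
  obtain ⟨u, rfl⟩ := mk₀_surjective y
  have h1 : i ≫ Injective.factorThru u i = u := Injective.comp_factorThru u i
  rw [← h1, ← Abelian.Ext.mk₀_comp_mk₀_assoc]
  have hsub := hX₀.subsingleton_ext_left hX''
  have h2 : (Abelian.Ext.mk₀ (Injective.factorThru u i)).comp hc.extClass (zero_add 1) = 0 :=
    hsub.elim _ _
  rw [h2, Abelian.Ext.comp_zero]

end Approximation

section HomFunctorExt

variable {A : Type u} [Ring A] {T : Type u} [AddCommGroup T] [Module A T]

variable (A T) in
lemma isIso_homRegular_id : IsIso (homRegular (𝟙 (ModuleCat.of A T))) := by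
  rw [ConcreteCategory.isIso_iff_bijective]
  exact ⟨fun b c h => MulOpposite.unop_injective h, fun f => ⟨MulOpposite.op f, rfl⟩⟩

lemma projective_homFunctor_obj {M : ModuleCat.{u} A} (h : IsSummandOfSum (ModuleCat.of A T) M) :
    Projective ((homFunctor A T).obj M) := by
  have := isIso_homRegular_id A T
  have hB : Projective (ModuleCat.of (TiltedAlgebra A T) (TiltedAlgebra A T)) := by
    rw [← IsProjective.iff_projective]
    exact inferInstanceAs (Module.Projective (TiltedAlgebra A T) (TiltedAlgebra A T))
  have : Projective ((homFunctor A T).obj (ModuleCat.of A T)) :=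
    Projective.of_iso (asIso (homRegular (𝟙 (ModuleCat.of A T)))) hB
  exact (h.map (homFunctor A T)).projective

/-- `Hom_A(T, -)` is fully faithful on morphisms from direct summands of sums of copies of `T`. -/
lemma homFunctor_map_bijective_of_isSummandOfSum {M : ModuleCat.{u} A}
    (h : IsSummandOfSum (ModuleCat.of A T) M) (Y : ModuleCat.{u} A) :
    Function.Bijective ((homFunctor A T).map : (M ⟶ Y) → _) := by
  obtain ⟨n, a, b, e⟩ := h
  constructor
  · intro f g hfg
    have hb (j : Fin n) : b j ≫ f = b j ≫ g := by
      have h1 : (homFunctor A T).map (b j ≫ f) = (homFunctor A T).map (b j ≫ g) := by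
        rw [Functor.map_comp, Functor.map_comp, hfg]
      exact ModuleCat.hom_ext (congrArg (fun k : (homFunctor A T).obj (ModuleCat.of A T) ⟶
        (homFunctor A T).obj Y => (show T →ₗ[A] Y from k (show T →ₗ[A] T from LinearMap.id))) h1)
    rw [← Category.id_comp f, ← Category.id_comp g, ← e, Preadditive.sum_comp,
      Preadditive.sum_comp]
    simp only [Category.assoc, hb]
  · intro ψ
    have hT (χ : (homFunctor A T).obj (ModuleCat.of A T) ⟶ (homFunctor A T).obj Y) :
        ∃ f : ModuleCat.of A T ⟶ Y, (homFunctor A T).map f = χ := by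
      refine ⟨ModuleCat.ofHom (show T →ₗ[A] Y from χ (show T →ₗ[A] T from LinearMap.id)), ?_⟩
      refine ModuleCat.hom_ext (LinearMap.ext fun u => ?_)
      exact (map_smul χ.hom (MulOpposite.op (show T →ₗ[A] T from u))
        (show T →ₗ[A] T from LinearMap.id)).symm
    choose f hf using fun j => hT ((homFunctor A T).map (b j) ≫ ψ)
    refine ⟨∑ j, a j ≫ f j, ?_⟩
    rw [Functor.map_sum]
    simp only [Functor.map_comp, hf]
    simp only [← Category.assoc, ← Functor.map_comp]
    rw [← Preadditive.sum_comp, ← Functor.map_sum, e, CategoryTheory.Functor.map_id,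
      Category.id_comp]

lemma shortExact_homFunctor {X₁ X₂ X₃ : ModuleCat.{u} A} {i : X₁ ⟶ X₂} {p : X₂ ⟶ X₃}
    {h : i ≫ p = 0} (hS : (ShortComplex.mk i p h).ShortExact)
    (hlift : ∀ u : ModuleCat.of A T ⟶ X₃, ∃ v : ModuleCat.of A T ⟶ X₂, v ≫ p = u) :
    (ShortComplex.mk ((homFunctor A T).map i) ((homFunctor A T).map p)
      (by rw [← Functor.map_comp, h, Functor.map_zero])).ShortExact := by
  have hf : Mono i := hS.mono_f
  refine shortExact_moduleCat _ ?_ ?_ ?_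
  · intro u v huv
    have h1 : ModuleCat.ofHom (show T →ₗ[A] X₁ from u) ≫ i =
        ModuleCat.ofHom (show T →ₗ[A] X₁ from v) ≫ i := ModuleCat.hom_ext huv
    exact congrArg ModuleCat.Hom.hom ((cancel_mono i).1 h1)
  · intro u hu
    have h1 : ModuleCat.ofHom (show T →ₗ[A] X₂ from u) ≫ p = 0 := ModuleCat.hom_ext hu
    exact ⟨(hS.exact.lift _ h1).hom, congrArg ModuleCat.Hom.hom (hS.exact.lift_f _ h1)⟩
  · intro u
    obtain ⟨v, hv⟩ := hlift (ModuleCat.ofHom (show T →ₗ[A] X₃ from u))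
    exact ⟨v.hom, congrArg ModuleCat.Hom.hom hv⟩

variable (T) in
/-- `X` is adapted to `Hom_A(T, -)`: the `B`-module `Hom_A(T, X)` has the properties which hold if
`X` has a resolution by direct summands of sums of copies of `T`. It has projective dimension at most
one, it has no extensions with modules `Hom_A(T, J)` for `J` injective, and `Hom_A(T, -)` is fully
faithful on morphisms from `X`. -/
structure IsHomAdapted (X : ModuleCat.{u} A) : Prop where
  ext_two (Y : ModuleCat.{u} (TiltedAlgebra A T)) :
    Subsingleton (Abelian.Ext.{u} ((homFunctor A T).obj X) Y 2)
  ext_one (J : ModuleCat.{u} A) [Injective J] :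
    Subsingleton (Abelian.Ext.{u} ((homFunctor A T).obj X) ((homFunctor A T).obj J) 1)
  bijective (Y : ModuleCat.{u} A) : Function.Bijective ((homFunctor A T).map : (X ⟶ Y) → _)

/-- The vanishing and fullness statements are read off the projective resolution
`0 → Hom_A(T, X') → Hom_A(T, X₀) → Hom_A(T, X) → 0` over `B`. -/
lemma IsTilting.isHomAdapted (hT : IsTilting A T) (hA : IsHereditary A) (K : Type u)
    [CommRing K] [IsNoetherianRing K] [Algebra K A] [Module.Finite K A] [Module K T]
    [IsScalarTower K A T] (X : ModuleCat.{u} A) [Module.Finite A X]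
    (hX : Subsingleton (Abelian.Ext.{u} (ModuleCat.of A T) X 1)) :
    IsHomAdapted T X := by
  obtain ⟨X', X₀, i, p, h, hS, hX', hX₀, hlift⟩ := hT.exists_resolution hA K X hX
  have hG := shortExact_homFunctor hS hlift
  have hi : Mono i := hS.mono_f
  have hp : Epi p := hS.epi_g
  have hGp : Epi ((homFunctor A T).map p) := hG.epi_g
  have hP' := projective_homFunctor_obj hX'
  have hP₀ := projective_homFunctor_obj hX₀
  refine ⟨fun Y => ?_, fun J _ => ?_, fun Y => ⟨?_, ?_⟩⟩
  · refine subsingleton_of_forall_eq 0 fun x => ?_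
    obtain ⟨y, rfl⟩ := Abelian.Ext.contravariant_sequence_exact₃ hG Y x
      (Abelian.Ext.eq_zero_of_projective _) (show 1 + 1 = 2 from rfl)
    have hy : y = 0 := Abelian.Ext.eq_zero_of_projective _
    rw [hy, Abelian.Ext.comp_zero]
  · refine subsingleton_of_forall_eq 0 fun x => ?_
    obtain ⟨y, rfl⟩ := Abelian.Ext.contravariant_sequence_exact₃ hG _ x
      (Abelian.Ext.eq_zero_of_projective _) (add_zero 1)
    obtain ⟨w, rfl⟩ := mk₀_surjective y
    obtain ⟨w₀, rfl⟩ := (homFunctor_map_bijective_of_isSummandOfSum hX' J).2 w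
    have h1 : (homFunctor A T).map i ≫ (homFunctor A T).map (Injective.factorThru w₀ i) =
        (homFunctor A T).map w₀ := by
      rw [← Functor.map_comp, Injective.comp_factorThru]
    rw [← h1, ← Abelian.Ext.mk₀_comp_mk₀]
    exact hG.extClass_comp_assoc _
  · intro f g hfg
    rw [← cancel_epi p]
    refine (homFunctor_map_bijective_of_isSummandOfSum hX₀ Y).1 ?_
    rw [Functor.map_comp, Functor.map_comp, hfg]
  · intro ψ
    obtain ⟨l, hl⟩ := (homFunctor_map_bijective_of_isSummandOfSum hX₀ Y).2
      ((homFunctor A T).map p ≫ ψ)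
    have h0 : i ≫ l = 0 := by
      refine (homFunctor_map_bijective_of_isSummandOfSum hX' Y).1 ?_
      rw [Functor.map_comp, hl, ← Category.assoc, ← Functor.map_comp, h, Functor.map_zero,
        Functor.map_zero, Limits.zero_comp]
    refine ⟨hS.exact.desc l h0, ?_⟩
    have h1 : p ≫ hS.exact.desc l h0 = l := hS.exact.g_desc l h0
    rw [← cancel_epi ((homFunctor A T).map p), ← Functor.map_comp, h1, hl]

end HomFunctorExt

/-! ### The Auslander-Reiten translates of `T` -/

section OfOpOp

variable {A : Type u} [Ring A]

lemma epi_ofOpOp_map {X Y : ModuleCat.{u} Aᵐᵒᵖᵐᵒᵖ} (f : X ⟶ Y) [hf : Epi f] :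
    Epi ((ofOpOp A).map f) := by
  rw [ModuleCat.epi_iff_surjective] at hf ⊢
  exact hf

lemma exact_ofOpOp_map {X Y Z : ModuleCat.{u} Aᵐᵒᵖᵐᵒᵖ} {f : X ⟶ Y} {g : Y ⟶ Z} {h : f ≫ g = 0}
    (hex : (ShortComplex.mk f g h).Exact) :
    (ShortComplex.mk ((ofOpOp A).map f) ((ofOpOp A).map g)
      (by rw [← Functor.map_comp, h, Functor.map_zero])).Exact := by
  rw [ShortComplex.moduleCat_exact_iff] at hex ⊢
  exact hex

end OfOpOp

section Translates

variable {A : Type u} [Ring A] {T : Type u} [AddCommGroup T] [Module A T]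
  {P₁ P₀ : ModuleCat.{u} A} {i : P₁ ⟶ P₀} {p : P₀ ⟶ ModuleCat.of A T} {hip : i ≫ p = 0}
  (hP : (ShortComplex.mk i p hip).ShortExact)
  {Q₁ Q₀ : ModuleCat.{u} Aᵐᵒᵖ} {q : Q₁ ⟶ Q₀}
  {r : Q₀ ⟶ (dual (Subring.center A) A).obj (op (ModuleCat.of A T))} {hqr : q ≫ r = 0}
  (hQ : (ShortComplex.mk q r hqr).ShortExact)

/-- The inclusion `τ T → ν P₁`. -/
def tauInclusion : (tau A).obj (ModuleCat.of A T) ⟶ (nakayama (Subring.center A) A).obj P₁ :=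
  (dualLeft (Subring.center A) A).map (starConnecting hP).op

/-- The projection `Hom(Q₁, A) → τ⁻¹ T`. -/
def tauInvProjection : (starRight A).obj (op Q₁) ⟶ (tauInv A).obj (ModuleCat.of A T) :=
  (ofOpOp A).map (starConnecting hQ)

lemma tauInclusion_comp :
    tauInclusion hP ≫ (nakayama (Subring.center A) A).map i = 0 := by
  have h := congrArg (fun k => (dualLeft (Subring.center A) A).map k.op)
    (star_comp_starConnecting hP)
  exact ((dualLeft (Subring.center A) A).map_comp _ _).symm.trans
    (h.trans ((dualLeft (Subring.center A) A).map_zero _ _))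

lemma exact_tauInclusion [IsSemisimpleRing (Subring.center A)] :
    (ShortComplex.mk (tauInclusion hP) ((nakayama (Subring.center A) A).map i)
      (tauInclusion_comp hP)).Exact :=
  dualLeft_exact (K := Subring.center A) (exact_starConnecting hP)

lemma mono_tauInclusion [Projective P₀] : Mono (tauInclusion hP) := by
  have := epi_starConnecting hP
  exact mono_dualLeft_map (starConnecting hP)

lemma tauInclusion_naturality (φ : ShortComplex.mk i p hip ⟶ ShortComplex.mk i p hip) :
    tauInclusion hP ≫ (nakayama (Subring.center A) A).map φ.τ₁ =
      (tau A).map φ.τ₃ ≫ tauInclusion hP := by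
  have h := congrArg (fun k => (dualLeft (Subring.center A) A).map k.op)
    (starConnecting_naturality hP φ)
  exact ((dualLeft (Subring.center A) A).map_comp _ _).symm.trans
    (h.trans ((dualLeft (Subring.center A) A).map_comp _ _))

lemma comp_tauInvProjection :
    (starRight A).map q.op ≫ tauInvProjection hQ = 0 := by
  have h := congrArg (fun k => (ofOpOp A).map k) (star_comp_starConnecting hQ)
  exact ((ofOpOp A).map_comp _ _).symm.trans (h.trans ((ofOpOp A).map_zero _ _))

lemma exact_tauInvProjection :
    (ShortComplex.mk ((starRight A).map q.op) (tauInvProjection hQ)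
      (comp_tauInvProjection hQ)).Exact :=
  exact_ofOpOp_map (exact_starConnecting hQ)

lemma epi_tauInvProjection [Projective Q₀] : Epi (tauInvProjection hQ) := by
  have := epi_starConnecting hQ
  exact epi_ofOpOp_map (starConnecting hQ)

lemma tauInvProjection_naturality (φ : ShortComplex.mk q r hqr ⟶ ShortComplex.mk q r hqr)
    (β : ModuleCat.of A T ⟶ ModuleCat.of A T)
    (h : φ.τ₃ = (dual (Subring.center A) A).map β.op) :
    tauInvProjection hQ ≫ (tauInv A).map β =
      (starRight A).map φ.τ₁.op ≫ tauInvProjection hQ := by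
  have h1 := starConnecting_naturality hQ φ
  rw [h] at h1
  have h2 := congrArg (fun k => (ofOpOp A).map k) h1
  exact ((ofOpOp A).map_comp _ _).symm.trans (h2.symm.trans ((ofOpOp A).map_comp _ _))

end Translates

/-! ### The three bimodules as quotients of one group -/

section Main

variable {A : Type u} [Ring A] {T : Type u} [AddCommGroup T] [Module A T]
  {P₁ P₀ : ModuleCat.{u} A} {i : P₁ ⟶ P₀} {p : P₀ ⟶ ModuleCat.of A T} {hip : i ≫ p = 0}
  (hP : (ShortComplex.mk i p hip).ShortExact)
  {Q₁ Q₀ : ModuleCat.{u} Aᵐᵒᵖ} {q : Q₁ ⟶ Q₀}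
  {r : Q₀ ⟶ (dual (Subring.center A) A).obj (op (ModuleCat.of A T))} {hqr : q ≫ r = 0}
  (hQ : (ShortComplex.mk q r hqr).ShortExact)

/-- The map `Hom_A(P₁, Hom(Q₁, A)) → Ext¹(T, τ⁻¹ T)`. -/
def toExtTauInv : (P₁ ⟶ (starRight A).obj (op Q₁)) →+ (extTauInvBimod A T).carrier :=
  sandwich hP.extClass (Abelian.Ext.mk₀.{u} (tauInvProjection hQ)) (add_zero 1)

lemma toExtTauInv_surjective [Projective P₁] [Projective P₀] [Projective Q₀] :
    Function.Surjective (toExtTauInv hP hQ) := by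
  have := epi_tauInvProjection hQ
  exact surjective_sandwich_of_projective (tauInvProjection hQ) hP

lemma toExtTauInv_eq_zero_iff [Projective P₁] [Projective P₀] [Projective Q₀]
    (f : P₁ ⟶ (starRight A).obj (op Q₁)) :
    toExtTauInv hP hQ f = 0 ↔ Decomposes i ((starRight A).map q.op) f := by
  have := epi_tauInvProjection hQ
  exact sandwich_eq_zero_iff_of_projective _ (tauInvProjection hQ) _ (exact_tauInvProjection hQ)
    hP f

lemma toExtTauInv_smul (b : TiltedAlgebra A T)
    (φ : ShortComplex.mk i p hip ⟶ ShortComplex.mk i p hip) (hφ : φ.τ₃ = ModuleCat.ofHom b.unop)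
    (f : P₁ ⟶ (starRight A).obj (op Q₁)) :
    toExtTauInv hP hQ (φ.τ₁ ≫ f) = b • toExtTauInv hP hQ f := by
  refine sandwich_precomp hP.extClass _ (add_zero 1) (ModuleCat.ofHom b.unop) φ.τ₁ ?_ f
  rw [← hφ]
  exact hP.extClass_naturality hP φ

lemma toExtTauInv_op_smul (b : TiltedAlgebra A T)
    (φ : ShortComplex.mk q r hqr ⟶ ShortComplex.mk q r hqr)
    (hφ : φ.τ₃ = (dual (Subring.center A) A).map (ModuleCat.ofHom b.unop).op)
    (f : P₁ ⟶ (starRight A).obj (op Q₁)) :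
    toExtTauInv hP hQ (f ≫ (starRight A).map φ.τ₁.op) =
      MulOpposite.op b • toExtTauInv hP hQ f := by
  refine sandwich_postcomp hP.extClass _ (add_zero 1) ((tauInv A).map (ModuleCat.ofHom b.unop))
    ((starRight A).map φ.τ₁.op) ?_ f
  rw [Abelian.Ext.mk₀_comp_mk₀, Abelian.Ext.mk₀_comp_mk₀,
    tauInvProjection_naturality hQ φ _ hφ]

/-- An endomorphism of a short exact sequence ending in `D T` dualizes to an endomorphism of the
sequence starting in `T`. -/
def codualMap (β : ModuleCat.of A T ⟶ ModuleCat.of A T)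
    (φ : ShortComplex.mk q r hqr ⟶ ShortComplex.mk q r hqr)
    (hφ : φ.τ₃ = (dual (Subring.center A) A).map β.op) :
    codualComplex (Subring.center A) A q r hqr ⟶ codualComplex (Subring.center A) A q r hqr where
  τ₁ := β
  τ₂ := (dualLeft (Subring.center A) A).map φ.τ₂.op
  τ₃ := (dualLeft (Subring.center A) A).map φ.τ₁.op
  comm₁₂ := by
    have h : φ.τ₂ ≫ r = r ≫ φ.τ₃ := φ.comm₂₃
    rw [hφ] at h
    exact comp_dualFlip r r β φ.τ₂ h
  comm₂₃ := by
    have h : φ.τ₁ ≫ q = q ≫ φ.τ₂ := φ.comm₁₂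
    change (dualLeft (Subring.center A) A).map φ.τ₂.op ≫ (dualLeft (Subring.center A) A).map q.op =
      (dualLeft (Subring.center A) A).map q.op ≫ (dualLeft (Subring.center A) A).map φ.τ₁.op
    rw [← Functor.map_comp, ← Functor.map_comp, ← op_comp, ← op_comp, h]

variable (hJ : (codualComplex (Subring.center A) A q r hqr).ShortExact)

/-- The map `Hom_A(P₁, Hom(Q₁, A)) = Hom_A(ν P₁, D Q₁) → Ext¹(τ T, T)`. -/
def toExtTau : (P₁ ⟶ (starRight A).obj (op Q₁)) →+ (extTauBimod A T).carrier :=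
  (sandwich (Abelian.Ext.mk₀.{u} (tauInclusion hP)) hJ.extClass (zero_add 1)).comp
    (nakayamaHom (Subring.center A) P₁ Q₁)

lemma toExtTau_smul (b : TiltedAlgebra A T)
    (φ : ShortComplex.mk i p hip ⟶ ShortComplex.mk i p hip) (hφ : φ.τ₃ = ModuleCat.ofHom b.unop)
    (f : P₁ ⟶ (starRight A).obj (op Q₁)) :
    toExtTau hP hJ (φ.τ₁ ≫ f) = b • toExtTau hP hJ f := by
  refine sandwich_precomp (Abelian.Ext.mk₀ (tauInclusion hP)) hJ.extClass (zero_add 1)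
    ((tau A).map (ModuleCat.ofHom b.unop)) ((nakayama (Subring.center A) A).map φ.τ₁) ?_
    (nakayamaHom (Subring.center A) P₁ Q₁ f)
  rw [← hφ, Abelian.Ext.mk₀_comp_mk₀, Abelian.Ext.mk₀_comp_mk₀, tauInclusion_naturality]

lemma toExtTau_op_smul (b : TiltedAlgebra A T)
    (φ : ShortComplex.mk q r hqr ⟶ ShortComplex.mk q r hqr)
    (hφ : φ.τ₃ = (dual (Subring.center A) A).map (ModuleCat.ofHom b.unop).op)
    (f : P₁ ⟶ (starRight A).obj (op Q₁)) :
    toExtTau hP hJ (f ≫ (starRight A).map φ.τ₁.op) = MulOpposite.op b • toExtTau hP hJ f :=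
  sandwich_postcomp (Abelian.Ext.mk₀ (tauInclusion hP)) hJ.extClass (zero_add 1)
    (ModuleCat.ofHom b.unop) ((dualLeft (Subring.center A) A).map φ.τ₁.op)
    (hJ.extClass_naturality hJ (codualMap _ φ hφ)) (nakayamaHom (Subring.center A) P₁ Q₁ f)

variable (hH : (dualHomComplex (K := Subring.center A) i p hip).ShortExact)
  {hz : dualFlip r ≫ (dualLeft (Subring.center A) A).map q.op = 0}
  (hG : (homComplex (dualFlip r) ((dualLeft (Subring.center A) A).map q.op) hz).ShortExact)

/-- The map `Hom_A(ν P, D Q) → Hom_B(D Hom_A(P, T), Hom_A(T, D Q))`. -/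
def homOfNakayama (T : Type u) [AddCommGroup T] [Module A T] (P J : ModuleCat.{u} A) :
    ((nakayama (Subring.center A) A).obj P ⟶ J) →+
      ((dualHom (Subring.center A) A T).obj P ⟶ (homFunctor A T).obj J) where
  toFun f := dualHomToHom P ≫ (homFunctor A T).map f
  map_zero' := by rw [Functor.map_zero, Limits.comp_zero]
  map_add' f g := by rw [Functor.map_add, Preadditive.comp_add]

/-- The map `Hom_A(P₁, Hom(Q₁, A)) = Hom_A(ν P₁, D Q₁) → Ext²(D B, B)`. -/
def toExtTwo : (P₁ ⟶ (starRight A).obj (op Q₁)) →+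
    (extTwoBimod (Subring.center A) (TiltedAlgebra A T)).carrier :=
  ((sandwich hH.extClass hG.extClass (show 1 + 1 = 2 from rfl)).comp
    (homOfNakayama T P₁ ((dualLeft (Subring.center A) A).obj (op Q₁)))).comp
    (nakayamaHom (Subring.center A) P₁ Q₁)

lemma toExtTwo_smul (b : TiltedAlgebra A T)
    (φ : ShortComplex.mk i p hip ⟶ ShortComplex.mk i p hip) (hφ : φ.τ₃ = ModuleCat.ofHom b.unop)
    (f : P₁ ⟶ (starRight A).obj (op Q₁)) :
    toExtTwo hH hG (φ.τ₁ ≫ f) = b • toExtTwo hH hG f := by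
  let ψ : dualHomComplex (K := Subring.center A) i p hip ⟶
      dualHomComplex (K := Subring.center A) i p hip :=
    { τ₁ := (dualHom (Subring.center A) A T).map φ.τ₁
      τ₂ := (dualHom (Subring.center A) A T).map φ.τ₂
      τ₃ := (dualRegularAct (Subring.center A) (TiltedAlgebra A T) b).unop
      comm₁₂ := by
        have h : φ.τ₁ ≫ i = i ≫ φ.τ₂ := φ.comm₁₂
        change (dualHom (Subring.center A) A T).map φ.τ₁ ≫ (dualHom (Subring.center A) A T).map i =
          (dualHom (Subring.center A) A T).map i ≫ (dualHom (Subring.center A) A T).map φ.τ₂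
        rw [← Functor.map_comp, ← Functor.map_comp, h]
      comm₂₃ := dualHomToDualRegular_naturality p φ.τ₂ b (by rw [← hφ]; exact φ.comm₂₃) }
  exact sandwich_precomp hH.extClass hG.extClass (show 1 + 1 = 2 from rfl)
    (dualRegularAct (Subring.center A) (TiltedAlgebra A T) b).unop
    ((dualHom (Subring.center A) A T).map φ.τ₁) (hH.extClass_naturality hH ψ)
    (homOfNakayama T P₁ ((dualLeft (Subring.center A) A).obj (op Q₁))
      (nakayamaHom (Subring.center A) P₁ Q₁ f))

lemma toExtTwo_op_smul (b : TiltedAlgebra A T)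
    (φ : ShortComplex.mk q r hqr ⟶ ShortComplex.mk q r hqr)
    (hφ : φ.τ₃ = (dual (Subring.center A) A).map (ModuleCat.ofHom b.unop).op)
    (f : P₁ ⟶ (starRight A).obj (op Q₁)) :
    toExtTwo hH hG (f ≫ (starRight A).map φ.τ₁.op) = MulOpposite.op b • toExtTwo hH hG f := by
  let χ := codualMap (ModuleCat.ofHom b.unop) φ hφ
  let ψ : homComplex (dualFlip r) ((dualLeft (Subring.center A) A).map q.op) hz ⟶
      homComplex (dualFlip r) ((dualLeft (Subring.center A) A).map q.op) hz :=
    { τ₁ := actHom (TiltedAlgebra A T) (TiltedAlgebra A T)ᵐᵒᵖ (TiltedAlgebra A T)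
        (MulOpposite.op b)
      τ₂ := (homFunctor A T).map ((dualLeft (Subring.center A) A).map φ.τ₂.op)
      τ₃ := (homFunctor A T).map ((dualLeft (Subring.center A) A).map φ.τ₁.op)
      comm₁₂ := homRegular_naturality (dualFlip r)
        ((dualLeft (Subring.center A) A).map φ.τ₂.op) b χ.comm₁₂
      comm₂₃ := congrArg (fun k => (homFunctor A T).map k) χ.comm₂₃ }
  exact sandwich_postcomp hH.extClass hG.extClass (show 1 + 1 = 2 from rfl)
    (actHom (TiltedAlgebra A T) (TiltedAlgebra A T)ᵐᵒᵖ (TiltedAlgebra A T) (MulOpposite.op b))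
    ((homFunctor A T).map ((dualLeft (Subring.center A) A).map φ.τ₁.op))
    (hG.extClass_naturality hG ψ)
    (homOfNakayama T P₁ ((dualLeft (Subring.center A) A).obj (op Q₁))
      (nakayamaHom (Subring.center A) P₁ Q₁ f))

lemma homOfNakayama_bijective (P J : ModuleCat.{u} A) [Module.Finite A P] [Projective P]
    (h : IsHomAdapted T ((nakayama (Subring.center A) A).obj P)) :
    Function.Bijective (homOfNakayama T P J) := by
  have := isIso_dualHomToHom (K := Subring.center A) (T := T) P
  constructor
  · intro f g hfg
    exact (h.bijective J).1 ((cancel_epi (dualHomToHom P)).1 hfg)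
  · intro ψ
    obtain ⟨f, hf⟩ := (h.bijective J).2 (inv (dualHomToHom P) ≫ ψ)
    refine ⟨f, ?_⟩
    change dualHomToHom P ≫ (homFunctor A T).map f = ψ
    rw [hf, IsIso.hom_inv_id_assoc]

lemma subsingleton_ext_dualHom (P : ModuleCat.{u} A) [Module.Finite A P] [Projective P]
    {Y : ModuleCat.{u} (TiltedAlgebra A T)} {n : ℕ}
    (h : Subsingleton (Abelian.Ext.{u}
      ((homFunctor A T).obj ((nakayama (Subring.center A) A).obj P)) Y n)) :
    Subsingleton (Abelian.Ext.{u} ((dualHom (Subring.center A) A T).obj P) Y n) := by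
  have := isIso_dualHomToHom (K := Subring.center A) (T := T) P
  exact ((IsSummandOfSum.refl _).of_retract
    (asIso (dualHomToHom (K := Subring.center A) (T := T) P)).retract).subsingleton_ext_left h

variable [IsSemisimpleRing (Subring.center A)] [Module.Finite (Subring.center A) A]
  [Module.Finite A P₁] [Projective P₁] [Projective P₀]

lemma toExtTau_surjective [Injective ((dualLeft (Subring.center A) A).obj (op Q₀))]
    [Injective ((dualLeft (Subring.center A) A).obj (op Q₁))] :
    Function.Surjective (toExtTau hP hJ) := by
  have := mono_tauInclusion hP
  exact (surjective_sandwich_of_injective (tauInclusion hP) hJ).comp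
    (nakayamaHom_surjective P₁ Q₁)

variable [Module.Finite A P₀]

lemma decomposes_nakayamaHom_iff (i : P₁ ⟶ P₀) (q : Q₁ ⟶ Q₀)
    (f : P₁ ⟶ (starRight A).obj (op Q₁)) :
    Decomposes ((nakayama (Subring.center A) A).map i) ((dualLeft (Subring.center A) A).map q.op)
      (nakayamaHom (Subring.center A) P₁ Q₁ f) ↔ Decomposes i ((starRight A).map q.op) f :=
  decomposes_iff (nakayamaHom (Subring.center A) P₁ Q₁) (nakayamaHom (Subring.center A) P₀ Q₁)
    (nakayamaHom (Subring.center A) P₁ Q₀) (nakayamaHom_injective P₁ Q₁)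
    (nakayamaHom_surjective P₀ Q₁) (nakayamaHom_surjective P₁ Q₀)
    (fun g => nakayamaHom_precomp i g) (fun h => nakayamaHom_postcomp q h) f

lemma toExtTau_eq_zero_iff [Injective ((dualLeft (Subring.center A) A).obj (op Q₀))]
    [Injective ((dualLeft (Subring.center A) A).obj (op Q₁))]
    (f : P₁ ⟶ (starRight A).obj (op Q₁)) :
    toExtTau hP hJ f = 0 ↔ Decomposes i ((starRight A).map q.op) f := by
  have := mono_tauInclusion hP
  rw [← decomposes_nakayamaHom_iff]
  exact sandwich_eq_zero_iff_of_injective (tauInclusion hP) _ _ (exact_tauInclusion hP) hJ _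

variable (h₁ : IsHomAdapted T ((nakayama (Subring.center A) A).obj P₁))
  (h₀ : IsHomAdapted T ((nakayama (Subring.center A) A).obj P₀))
  [Injective ((dualLeft (Subring.center A) A).obj (op Q₀))]

include h₁ h₀ in
lemma toExtTwo_surjective : Function.Surjective (toExtTwo hH hG) :=
  ((surjective_sandwich_of_ext_vanishing hH hG
      (subsingleton_ext_dualHom P₁ (h₁.ext_one _))
      (subsingleton_ext_dualHom P₀ (h₀.ext_two _))).comp
    (homOfNakayama_bijective P₁ _ h₁).2).comp (nakayamaHom_surjective P₁ Q₁)

include h₁ h₀ in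
lemma toExtTwo_eq_zero_iff (f : P₁ ⟶ (starRight A).obj (op Q₁)) :
    toExtTwo hH hG f = 0 ↔ Decomposes i ((starRight A).map q.op) f := by
  rw [← decomposes_nakayamaHom_iff]
  refine (sandwich_eq_zero_iff_of_ext_vanishing hH hG
    (subsingleton_ext_dualHom P₀ (h₀.ext_one _)) _).trans ?_
  exact decomposes_iff (homOfNakayama T P₁ _) (homOfNakayama T P₀ _) (homOfNakayama T P₁ _)
    (homOfNakayama_bijective P₁ _ h₁).1 (homOfNakayama_bijective P₀ _ h₀).2
    (homOfNakayama_bijective P₁ _ h₁).2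
    (fun g => by
      change dualHomToHom P₁ ≫ (homFunctor A T).map (_ ≫ g) =
        (dualHom (Subring.center A) A T).map i ≫ dualHomToHom P₀ ≫ (homFunctor A T).map g
      rw [Functor.map_comp, ← Category.assoc, ← dualHomToHom_naturality, Category.assoc])
    (fun h => by
      change dualHomToHom P₁ ≫ (homFunctor A T).map (h ≫ _) =
        (dualHomToHom P₁ ≫ (homFunctor A T).map h) ≫ (homFunctor A T).map _
      rw [Functor.map_comp, Category.assoc]) _

end Main

end

end TiltedAlg

theorem mainTheorem1 (k : Type v) [CommRing k] [IsArtinianRing k]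
    (A : Type u) [Ring A] [Algebra k A] [Module.Finite k A] (hA : TiltedAlg.IsHereditary A)
    (T : Type u) [AddCommGroup T] [Module A T] (hT : TiltedAlg.IsTilting A T) :
    Nonempty (TiltedAlg.Bimod.Iso
      (TiltedAlg.extTwoBimod (Subring.center A) (TiltedAlg.TiltedAlgebra A T))
      (TiltedAlg.extTauInvBimod A T)) ∧
    Nonempty (TiltedAlg.Bimod.Iso
      (TiltedAlg.extTauInvBimod A T)
      (TiltedAlg.extTauBimod A T)) := by
  have hss : IsSemisimpleRing (Subring.center A) := TiltedAlg.isSemisimpleRing_center (k := k) hA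
  have hfin : Module.Finite (Subring.center A) A := TiltedAlg.finite_center (k := k)
  have hnoeth : IsNoetherianRing A := isNoetherian_of_tower (Subring.center A) inferInstance
  have hnoeth' : IsNoetherianRing Aᵐᵒᵖ := isNoetherian_of_tower (Subring.center A) inferInstance
  have hTfin : Module.Finite A (ModuleCat.of A T) := hT.finite
  obtain ⟨P₁, P₀, i, p, hip, hP, hP₀, hP₀f, hP₁f⟩ :=
    TiltedAlg.exists_presentation (ModuleCat.of A T)
  have hP₁ : Projective P₁ := by
    have := (hP.hasProjectiveDimensionLT_X₃_iff 0 hP₀).1 hT.projectiveDimension_le_one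
    exact projective_iff_hasProjectiveDimensionLT_one.2 this
  have hDT := TiltedAlg.finite_dual (Subring.center A) A (ModuleCat.of A T)
  obtain ⟨Q₁, Q₀, q, r, hqr, hQ, hQ₀, -, -⟩ := TiltedAlg.exists_presentation
    ((TiltedAlg.dual (Subring.center A) A).obj (op (ModuleCat.of A T)))
  have hJ := TiltedAlg.shortExact_codualComplex (Subring.center A) A q r hqr hQ
  have hJ₀ : Injective ((TiltedAlg.dualLeft (Subring.center A) A).obj (op Q₀)) :=
    TiltedAlg.injective_dualLeft Q₀
  have hJ₁ : Injective ((TiltedAlg.dualLeft (Subring.center A) A).obj (op Q₁)) := by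
    have : Epi ((TiltedAlg.dualLeft (Subring.center A) A).map q.op) := hJ.epi_g
    exact hA.injective_of_epi ((TiltedAlg.dualLeft (Subring.center A) A).map q.op)
  have hH := TiltedAlg.shortExact_dualHomComplex (K := Subring.center A) hT.ext_one_self i p hip hP
  have hG := TiltedAlg.shortExact_homComplex hT.ext_one_self _ _ _ hJ
  have hν (P : ModuleCat.{u} A) [Module.Finite A P] [Projective P] :
      TiltedAlg.IsHomAdapted T
        ((TiltedAlg.nakayama (Subring.center A) A).obj P) := by
    have := TiltedAlg.finite_star P
    have := TiltedAlg.finite_dualLeft (Subring.center A) A ((TiltedAlg.star A).obj (op P))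
    have : Module.Finite A ((TiltedAlg.nakayama (Subring.center A) A).obj P) := this
    have := TiltedAlg.injective_nakayama (K := Subring.center A) P
    exact hT.isHomAdapted hA (Subring.center A) _
      (subsingleton_of_forall_eq 0 fun x => Abelian.Ext.eq_zero_of_injective x)
  refine ⟨TiltedAlg.Bimod.nonempty_iso_of_surjective (TiltedAlg.toExtTwo hH hG)
      (TiltedAlg.toExtTauInv hP hQ) (TiltedAlg.toExtTwo_surjective hH hG (hν P₁) (hν P₀))
      (TiltedAlg.toExtTauInv_surjective hP hQ) (fun f => ?_) (fun b => ?_) (fun b => ?_),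
    TiltedAlg.Bimod.nonempty_iso_of_surjective (TiltedAlg.toExtTauInv hP hQ)
      (TiltedAlg.toExtTau hP hJ) (TiltedAlg.toExtTauInv_surjective hP hQ)
      (TiltedAlg.toExtTau_surjective hP hJ) (fun f => ?_) (fun b => ?_) (fun b => ?_)⟩
  · rw [TiltedAlg.toExtTauInv_eq_zero_iff,
      TiltedAlg.toExtTwo_eq_zero_iff hH hG (hν P₁) (hν P₀)]
  · obtain ⟨φ, hφ⟩ := TiltedAlg.exists_lift_endomorphism hP (ModuleCat.ofHom b.unop)
    exact ⟨fun f => φ.τ₁ ≫ f, fun f => ⟨TiltedAlg.toExtTwo_smul hH hG b φ hφ f,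
      TiltedAlg.toExtTauInv_smul hP hQ b φ hφ f⟩⟩
  · obtain ⟨φ, hφ⟩ := TiltedAlg.exists_lift_endomorphism hQ
      ((TiltedAlg.dual (Subring.center A) A).map (ModuleCat.ofHom b.unop).op)
    exact ⟨fun f => f ≫ (TiltedAlg.starRight A).map φ.τ₁.op, fun f =>
      ⟨TiltedAlg.toExtTwo_op_smul hH hG b φ hφ f, TiltedAlg.toExtTauInv_op_smul hP hQ b φ hφ f⟩⟩
  · rw [TiltedAlg.toExtTauInv_eq_zero_iff, TiltedAlg.toExtTau_eq_zero_iff]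
  · obtain ⟨φ, hφ⟩ := TiltedAlg.exists_lift_endomorphism hP (ModuleCat.ofHom b.unop)
    exact ⟨fun f => φ.τ₁ ≫ f, fun f => ⟨TiltedAlg.toExtTauInv_smul hP hQ b φ hφ f,
      TiltedAlg.toExtTau_smul hP hJ b φ hφ f⟩⟩
  · obtain ⟨φ, hφ⟩ := TiltedAlg.exists_lift_endomorphism hQ
      ((TiltedAlg.dual (Subring.center A) A).map (ModuleCat.ofHom b.unop).op)
    exact ⟨fun f => f ≫ (TiltedAlg.starRight A).map φ.τ₁.op, fun f =>
      ⟨TiltedAlg.toExtTauInv_op_smul hP hQ b φ hφ f, TiltedAlg.toExtTau_op_smul hP hJ b φ hφ f⟩⟩
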